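/- Let $N,d,m\in\mathbb N$, $T>0$, $\lambda\ge 0$, let $A\subset\mathbb R^m$ be compact and non-empty, $\mathcal I=\{0,1\}^N$ and $\bar p=(1,\dots,1)$. For $p\in\mathcal I$ let $$\mathcal I_p=\{p'\in\mathcal I:\ p^i=1\Rightarrow p'^i=1,\ \text{and}\ p^l=0,\ p'^l=1\ \text{for some } l\}.$$ Let $f:\mathbb R^d\times A\times\mathcal I\to\mathbb R^d$ be continuous, bounded, and Lipschitz continuous in $x$ uniformly in $(a,p)$. Let $\ell:\mathbb R^d\times A\times\mathcal I\times[0,T]\to[0,\infty)$ be continuous, bounded, and uniformly continuous in $x$ uniformly in $(a,p,t)$. Let $C:\mathbb R^d\times\mathcal I\times\mathcal I\to[0,\infty)$ be uniformly continuous in $x$ uniformly in $p\in\mathcal I$, $p'\in\mathcal I_p$, and suppose that for every $p\ne\bar p$ the function $x\mapsto\min_{p'\in\mathcal I_p}C(x,p,p')$ is bounded (for instance, $C$ is bounded). For a measurable control $\alpha$ with values in $A$, let $y=y^{\alpha}_{(x,t,p)}$ be the absolutely continuous solution of $y'(s)=f(y(s),\alpha(s),p)$ for a.e. $s\in\,]t,T]$,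 $y(t)=x$. Define $V_p:\mathbb R^d\times[0,T]\to\mathbb R$ backwards by $V_{\bar p}\equiv 0$ and, for $p\neq\bar p$, $$V_p(x,t)=\inf_{\alpha,\ \tau\in[t,T],\ p'\in\mathcal I_p}\Big(\int_t^\tau e^{-\lambda(s-t)}\ell(y(s),\alpha(s),p,s)\,ds+e^{-\lambda(\tau-t)}\big(C(y(\tau),p,p')+V_{p'}(y(\tau),\tau)\big)\Big).$$ For $p\ne\bar p$ put $$\psi_p(x,t)=\inf_{p'\in\mathcal I_p}\big(C(x,p,p')+V_{p'}(x,t)\big),\qquad H^p(x,t,\xi)=\sup_{a\in A}\{-f(x,a,p)\cdot\xi-\ell(x,a,p,t)\}.$$ **Theorem.** For every $p\in\mathcal I$ with $p\neq\bar p$, the value function $V_p$ is the unique bounded and uniformly continuous function $u$ on $\mathbb R^d\times[0,T]$ that is a viscosity solution of $$\max\big\{u(x,t)-\psi_p(x,t),\ -u_t(x,t)+\lambda u(x,t)+H^p(x,t,D_xu(x,t))\big\}=0,\qquad (x,t)\in\mathbb R^d\times[0,T[,$$ and satisfies $u(x,T)=\psi_p(x,T)$ for all $x\in\mathbb R^d$.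 Here $u$ is a viscosity solution if, for every $\varphi\in C^1(\mathbb R^d\times\mathbb R)$ and every local maximum (respectively minimum) point $(x,t)$ of $u-\varphi$ relative to $\mathbb R^d\times[0,T[$, one has $\max\{u-\psi_p,\,-\varphi_t+\lambda u+H^p(x,t,D_x\varphi)\}\le 0$ (respectively $\ge 0$) at $(x,t)$. -/

import Mathlib

open Set MeasureTheory

noncomputable section

namespace OptimalVisiting

/-- The data of the relaxed optimal visiting problem with `N` targets in `ℝ^d` and controls in a
subset of `ℝ^m`.  A discrete state is a string in `{0,1}^N`, encoded as `Fin N → Bool`. -/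
structure Problem (d m N : ℕ) where
  /-- finite horizon -/
  T : ℝ
  /-- discount factor `λ` -/
  lam : ℝ
  /-- control set -/
  A : Set (EuclideanSpace ℝ (Fin m))
  /-- dynamics `f(x, a, p)` -/
  f : EuclideanSpace ℝ (Fin d) → A → (Fin N → Bool) → EuclideanSpace ℝ (Fin d)
  /-- running cost `ℓ(x, a, p, t)`; only the times `t ∈ [0, T]` are relevant -/
  l : EuclideanSpace ℝ (Fin d) → A → (Fin N → Bool) → ℝ → ℝ
  /-- switching cost `C(x, p, p')` -/
  C : EuclideanSpace ℝ (Fin d) → (Fin N → Bool) → (Fin N → Bool) → ℝ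

/-- The final discrete state `p̄ = (1, …, 1)`. -/
def pbar (N : ℕ) : Fin N → Bool := fun _ => true

/-- The set `I_p` of the discrete states that can be reached from `p` by one switch: no `1` is
lost, and at least one `0` becomes a `1`. -/
def switchSet {N : ℕ} (p : Fin N → Bool) : Set (Fin N → Bool) :=
  {p' | (∀ i, p i = true → p' i = true) ∧ ∃ j, p j = false ∧ p' j = true}

/-- The number of zeros of `p`. -/
def zeros {N : ℕ} (p : Fin N → Bool) : ℕ := (Finset.univ.filter fun i => p i = false).card

theorem zeros_lt {N : ℕ} {p p' : Fin N → Bool} (h : p' ∈ switchSet p) : zeros p' < zeros p := by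
  obtain ⟨h1, j, hj, hj'⟩ := h
  apply Finset.card_lt_card
  rw [Finset.ssubset_iff_of_subset]
  · exact ⟨j, by simp [hj], by simp [hj']⟩
  · intro i hi
    simp only [Finset.mem_filter, Finset.mem_univ, true_and] at hi ⊢
    by_contra hp
    have := h1 i (by simpa using hp)
    simp [hi] at this

namespace Problem

variable {d m N : ℕ} (P : Problem d m N)

/-- The standing hypotheses on the data. -/
structure Standing : Prop where
  T_pos : 0 < P.T
  lam_nonneg : 0 ≤ P.lam
  A_compact : IsCompact P.A
  A_nonempty : P.A.Nonempty
  f_continuous : Continuous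
    fun z : EuclideanSpace ℝ (Fin d) × P.A × (Fin N → Bool) => P.f z.1 z.2.1 z.2.2
  f_bounded : ∃ M : ℝ, ∀ x a p, ‖P.f x a p‖ ≤ M
  f_lipschitz : ∃ L : ℝ, 0 < L ∧ ∀ x y a p, ‖P.f x a p - P.f y a p‖ ≤ L * ‖x - y‖
  l_nonneg : ∀ x a p, ∀ t ∈ Icc 0 P.T, 0 ≤ P.l x a p t
  l_bounded : ∃ M : ℝ, ∀ x a p, ∀ t ∈ Icc 0 P.T, P.l x a p t ≤ M
  l_continuous : ContinuousOn
    (fun z : EuclideanSpace ℝ (Fin d) × P.A × (Fin N → Bool) × ℝ =>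
      P.l z.1 z.2.1 z.2.2.1 z.2.2.2) {z | z.2.2.2 ∈ Icc 0 P.T}
  l_unifCont : ∀ ε > 0, ∃ δ > 0, ∀ x y a p, ∀ t ∈ Icc 0 P.T,
    ‖x - y‖ < δ → |P.l x a p t - P.l y a p t| < ε
  C_nonneg : ∀ x p p', 0 ≤ P.C x p p'
  C_unifCont : ∀ ε > 0, ∃ δ > 0, ∀ x y p, ∀ p' ∈ switchSet p,
    ‖x - y‖ < δ → |P.C x p p' - P.C y p p'| < ε

/-- `y` is the (absolutely continuous) trajectory on `[t, T]` that starts from `x` at time `t`,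
for the control `α` and the frozen discrete state `p`. -/
def IsTrajectory (p : Fin N → Bool) (x : EuclideanSpace ℝ (Fin d)) (t : ℝ) (α : ℝ → P.A)
    (y : ℝ → EuclideanSpace ℝ (Fin d)) : Prop :=
  y t = x ∧ AbsolutelyContinuousOnInterval y t P.T ∧
    ∀ᵐ s : ℝ, s ∈ Ioc t P.T → HasDerivAt y (P.f (y s) (α s) p) s

/-- The discounted running cost `∫_t^τ e^{-λ(s-t)} ℓ(y(s), α(s), p, s) ds`. -/
def runningCost (p : Fin N → Bool) (t τ : ℝ) (α : ℝ → P.A)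
    (y : ℝ → EuclideanSpace ℝ (Fin d)) : ℝ :=
  ∫ s in t..τ, Real.exp (-P.lam * (s - t)) * P.l (y s) (α s) p s

open Classical in
/-- The value functions `V_p(x, t)`, `t ∈ [0, T]`, defined backwards from `V_p̄ = 0`:
`V_p(x, t)` is the infimum over the measurable controls `α`, the stopping times `τ ∈ [t, T]` and
the destinations `p' ∈ I_p` of
`∫_t^τ e^{-λ(s-t)} ℓ(y, α, p, s) ds + e^{-λ(τ-t)} (C(y(τ), p, p') + V_p'(y(τ), τ))`. -/
def value (p : Fin N → Bool) (x : EuclideanSpace ℝ (Fin d)) (t : ℝ) : ℝ :=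
  if p = pbar N then 0 else
    sInf {c : ℝ | ∃ (α : ℝ → P.A) (y : ℝ → EuclideanSpace ℝ (Fin d)) (τ : ℝ)
      (p' : Fin N → Bool) (_ : p' ∈ switchSet p),
      Measurable α ∧ P.IsTrajectory p x t α y ∧ τ ∈ Icc t P.T ∧
      c = P.runningCost p t τ α y
        + Real.exp (-P.lam * (τ - t)) * (P.C (y τ) p p' + value p' (y τ) τ)}
termination_by zeros p
decreasing_by exact zeros_lt ‹_›

/-- The stopping cost `ψ_p(x, t) = inf_{p' ∈ I_p} (C(x, p, p') + V_p'(x, t))`. -/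
def psi (p : Fin N → Bool) (x : EuclideanSpace ℝ (Fin d)) (t : ℝ) : ℝ :=
  ⨅ p' : switchSet p, (P.C x p p' + P.value p' x t)

/-- The Hamiltonian `H^p(x, t, ξ) = sup_{a ∈ A} (-f(x, a, p) · ξ - ℓ(x, a, p, t))`. -/
def hamiltonian (p : Fin N → Bool) (x : EuclideanSpace ℝ (Fin d)) (t : ℝ)
    (ξ : EuclideanSpace ℝ (Fin d)) : ℝ :=
  ⨆ a : P.A, (-inner ℝ (P.f x a p) ξ - P.l x a p t)

/-- The left-hand side of the obstacle equation at `(x, t)`, with the value `r` for `u(x, t)`, `q`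
for `u_t(x, t)` and `ξ` for `D_x u(x, t)`. -/
def obstacleOp (p : Fin N → Bool) (x : EuclideanSpace ℝ (Fin d)) (t r q : ℝ)
    (ξ : EuclideanSpace ℝ (Fin d)) : ℝ :=
  max (r - P.psi p x t) (-q + P.lam * r + P.hamiltonian p x t ξ)

/-- Viscosity subsolution of the obstacle equation on `ℝ^d × [0, T[`. -/
def IsViscositySubsolution (p : Fin N → Bool) (u : EuclideanSpace ℝ (Fin d) → ℝ → ℝ) : Prop :=
  ∀ φ : EuclideanSpace ℝ (Fin d) × ℝ → ℝ, ContDiff ℝ 1 φ →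
    ∀ (x : EuclideanSpace ℝ (Fin d)), ∀ t ∈ Ico 0 P.T,
      IsLocalMaxOn (fun z : EuclideanSpace ℝ (Fin d) × ℝ => u z.1 z.2 - φ z)
        (univ ×ˢ Ico 0 P.T) (x, t) →
      P.obstacleOp p x t (u x t) (deriv (fun s => φ (x, s)) t) (gradient (fun z => φ (z, t)) x) ≤ 0

/-- Viscosity supersolution of the obstacle equation on `ℝ^d × [0, T[`. -/
def IsViscositySupersolution (p : Fin N → Bool) (u : EuclideanSpace ℝ (Fin d) → ℝ → ℝ) : Prop :=
  ∀ φ : EuclideanSpace ℝ (Fin d) × ℝ → ℝ, ContDiff ℝ 1 φ →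
    ∀ (x : EuclideanSpace ℝ (Fin d)), ∀ t ∈ Ico 0 P.T,
      IsLocalMinOn (fun z : EuclideanSpace ℝ (Fin d) × ℝ => u z.1 z.2 - φ z)
        (univ ×ˢ Ico 0 P.T) (x, t) →
      0 ≤ P.obstacleOp p x t (u x t) (deriv (fun s => φ (x, s)) t) (gradient (fun z => φ (z, t)) x)

/-- `u` is bounded and uniformly continuous on `ℝ^d × [0, T]`. -/
def IsBUC (u : EuclideanSpace ℝ (Fin d) → ℝ → ℝ) : Prop :=
  (∃ K : ℝ, ∀ x, ∀ t ∈ Icc 0 P.T, |u x t| ≤ K) ∧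
    UniformContinuousOn (fun z : EuclideanSpace ℝ (Fin d) × ℝ => u z.1 z.2) (univ ×ˢ Icc 0 P.T)

/-- `u` is a bounded and uniformly continuous viscosity solution of the obstacle problem on
`ℝ^d × [0, T[` with the terminal condition `u(x, T) = ψ_p(x, T)`. -/
structure IsBUCSolution (p : Fin N → Bool) (u : EuclideanSpace ℝ (Fin d) → ℝ → ℝ) : Prop where
  buc : P.IsBUC u
  sub : P.IsViscositySubsolution p u
  super : P.IsViscositySupersolution p u
  terminal : ∀ x, u x P.T = P.psi p x P.T

end Problem

end OptimalVisiting

end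

/-!
The value functions are treated by backward induction on the number of zeros of the discrete state.

For a fixed `p ≠ p̄` the infimum over the destination `p'` can be taken inside, so that `V_p` is the
value function of an optimal stopping problem with stopping cost `ψ_p`.  If all `V_p'` with
`p' ∈ I_p` are bounded and uniformly continuous, so is `ψ_p`: it is a minimum of finitely many
uniformly continuous functions, bounded by the assumption on the cheapest switch
(`Standing.isBUC_psi`).  Trajectories with the same control depend
on the initial point in a Lipschitz way by Grönwall's inequality, which gives the modulus of
continuity of `V_p` in space; the modulus in time follows from the dynamic programming principle.
Controls are merely measurable, so trajectories are handled through the equivalent integral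
equation (`Standing.isTrajectory_iff`), whose solution is a fixed point of a contraction in a
weighted uniform norm (`exists_integral_solution`).  Concatenation of controls and restriction to a
final interval give the two halves of the dynamic programming principle,
`Standing.value_le_runningCost_add` and `Standing.runningCost_add_le_stoppingCost`.

For the viscosity property, `Standing.eventually_expansion` expands the running cost plus the
increment of a test function along short trajectories, with an error uniform in the control because
the control set is compact.  With a constant control it gives the subsolution property.  For the
supersolution property at a point where `V_p < ψ_p`, a near-optimal strategy does not stop
immediately, and the expansion is applied along that strategy.

Uniqueness is the comparison principle `Standing.le_of_subsolution_of_supersolution`, proved by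
doubling the variables.  A quadratic penalization at infinity produces a maximum point; its gradient
there is small because the solutions are bounded.  The running cost need not be uniformly continuous
in time on the whole space, so this penalization is fixed before that of the distance of the two
copies is made strong: the maximum point then lies in a known ball.  No boundary condition at
`t = 0` is needed, since test functions touch relative to `ℝ^d × [0, T[`.
-/

open Filter Topology

noncomputable section

namespace OptimalVisiting

/-! ### Integral equations with measurable time dependence -/

/-- Integral form of Grönwall's inequality. -/
theorem le_mul_exp_of_le_add_integral {u : ℝ → ℝ} {a b c L : ℝ} (hL : 0 < L)
    (hu : Continuous u) (hu0 : ∀ s ∈ Icc a b, 0 ≤ u s)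
    (h : ∀ s ∈ Icc a b, u s ≤ c + L * ∫ r in a..s, u r) :
    ∀ s ∈ Icc a b, u s ≤ c * Real.exp (L * (s - a)) := by
  intro s hs
  have hd : ∀ x, HasDerivAt (fun s => ∫ r in a..s, u r) (u x) x := fun x =>
    intervalIntegral.integral_hasDerivAt_right (hu.intervalIntegrable _ _)
      hu.stronglyMeasurable.stronglyMeasurableAtFilter hu.continuousAt
  have hpos : ∀ x ∈ Icc a b, 0 ≤ ∫ r in a..x, u r := fun x hx =>
    intervalIntegral.integral_nonneg hx.1 fun r hr => hu0 r ⟨hr.1, hr.2.trans hx.2⟩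
  have key := norm_le_gronwallBound_of_norm_deriv_right_le (f := fun s => ∫ r in a..s, u r)
    (f' := u) (δ := 0) (K := L) (ε := c) (a := a) (b := b)
    (fun x _ => (hd x).continuousAt.continuousWithinAt)
    (fun x _ => (hd x).hasDerivWithinAt) (by simp)
    (fun x hx => by
      have hx' : x ∈ Icc a b := ⟨hx.1, hx.2.le⟩
      rw [Real.norm_of_nonneg (hu0 x hx'), Real.norm_of_nonneg (hpos x hx')]
      linarith [h x hx']) s hs
  rw [Real.norm_of_nonneg (hpos s hs), gronwallBound_of_K_ne_0 hL.ne'] at key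
  have h1 := h s hs
  have h2 : L * ∫ r in a..s, u r ≤ c * (Real.exp (L * (s - a)) - 1) := by
    calc L * ∫ r in a..s, u r
        ≤ L * (0 * Real.exp (L * (s - a)) + c / L * (Real.exp (L * (s - a)) - 1)) := by gcongr
      _ = c * (Real.exp (L * (s - a)) - 1) := by field_simp; ring
  linarith

theorem le_mul_exp_of_le_add_integral_of_continuousOn {u : ℝ → ℝ} {a b c L : ℝ} (hL : 0 < L)
    (hu : ContinuousOn u (Icc a b)) (hu0 : ∀ s ∈ Icc a b, 0 ≤ u s)
    (h : ∀ s ∈ Icc a b, u s ≤ c + L * ∫ r in a..s, u r) :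
    ∀ s ∈ Icc a b, u s ≤ c * Real.exp (L * (s - a)) := by
  intro s hs
  have hab : a ≤ b := hs.1.trans hs.2
  have hv : ∀ r ∈ Icc a b, IccExtend hab ((Icc a b).domRestrict u) r = u r := fun r hr => by
    rw [IccExtend_of_mem _ _ hr]; rfl
  rw [← hv s hs]
  refine le_mul_exp_of_le_add_integral hL
    (continuousOn_iff_continuous_domRestrict.1 hu).Icc_extend'
    (fun r hr => (hv r hr).symm ▸ hu0 r hr) (fun r hr => ?_) s hs
  rw [hv r hr, intervalIntegral.integral_congr (g := u)]
  · exact h r hr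
  · intro q hq
    rw [uIcc_of_le hr.1] at hq
    exact hv q ⟨hq.1, hq.2.trans hr.2⟩

/-- Existence for the integral form of an ordinary differential equation whose right-hand side is
Lipschitz in the state and only measurable in time (Carathéodory).  In the unknown
`z(s) = e^{-2L(s-a)} y(s)` the Picard operator is a contraction with factor `1/2` on the whole
interval. -/
theorem exists_integral_solution {E : Type*} [NormedAddCommGroup E] [NormedSpace ℝ E]
    [CompleteSpace E] {G : E → ℝ → E} {M L : ℝ} (hL : 0 < L) (hM : ∀ x s, ‖G x s‖ ≤ M)
    (hG : ∀ x y s, ‖G x s - G y s‖ ≤ L * ‖x - y‖)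
    (hmeas : ∀ z : ℝ → E, Continuous z → StronglyMeasurable fun s => G (z s) s)
    (x : E) {a b : ℝ} (hab : a ≤ b) :
    ∃ y : ℝ → E, Continuous y ∧ ∀ s ∈ Icc a b, y s = x + ∫ r in a..s, G (y r) r := by
  have hint : ∀ z : ℝ → E, Continuous z → ∀ s t,
      IntervalIntegrable (fun r => G (z r) r) volume s t := fun z hz s t =>
    (intervalIntegrable_const (c := M)).mono_fun (hmeas z hz).aestronglyMeasurable
      (Eventually.of_forall fun r => (hM _ _).trans (le_abs_self M))
  let lift : C(Icc a b, E) → ℝ → E := fun z r =>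
    Real.exp (2 * L * (r - a)) • IccExtend hab z r
  have hlift : ∀ z, Continuous (lift z) := fun z => by
    have : Continuous (IccExtend hab z) := z.continuous.Icc_extend'
    fun_prop
  let Φ : C(Icc a b, E) → C(Icc a b, E) := fun z =>
    ⟨fun s => Real.exp (-(2 * L * (s - a))) • (x + ∫ r in a..(s : ℝ), G (lift z r) r), by
      have : Continuous fun s : ℝ => ∫ r in a..s, G (lift z r) r :=
        intervalIntegral.continuous_primitive (hint _ (hlift z)) a
      fun_prop⟩
  have hΦ : ContractingWith (1 / 2) Φ := by
    refine ⟨by norm_num [← NNReal.coe_lt_coe], LipschitzWith.of_dist_le_mul fun z w => ?_⟩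
    rw [ContinuousMap.dist_le (by positivity)]
    rintro ⟨s, hs⟩
    have hexp : ∫ r in a..s, Real.exp (2 * L * (r - a)) =
        (Real.exp (2 * L * (s - a)) - 1) / (2 * L) := by
      have hd : ∀ r ∈ uIcc a s, HasDerivAt (fun r => Real.exp (2 * L * (r - a)) / (2 * L))
          (Real.exp (2 * L * (r - a))) r := fun r _ => by
        have h1 : HasDerivAt (fun r : ℝ => 2 * L * (r - a)) (2 * L) r := by
          simpa using ((hasDerivAt_id r).sub_const a).const_mul (2 * L)
        have h2 := h1.exp.div_const (2 * L)
        rwa [mul_div_assoc, div_self (by positivity), mul_one] at h2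
      rw [intervalIntegral.integral_eq_sub_of_hasDerivAt hd
        (by apply Continuous.intervalIntegrable; fun_prop)]
      simp
      ring
    have hdiff : ‖(∫ r in a..s, G (lift z r) r) - ∫ r in a..s, G (lift w r) r‖ ≤
        L * dist z w * ((Real.exp (2 * L * (s - a)) - 1) / (2 * L)) := by
      rw [← intervalIntegral.integral_sub (hint _ (hlift z) _ _) (hint _ (hlift w) _ _), ← hexp,
        ← intervalIntegral.integral_const_mul]
      refine intervalIntegral.norm_integral_le_of_norm_le hs.1
        (Eventually.of_forall fun r _ => ?_) (by apply Continuous.intervalIntegrable; fun_prop)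
      refine (hG _ _ _).trans ?_
      simp only [lift]
      rw [← smul_sub, norm_smul, Real.norm_of_nonneg (Real.exp_pos _).le, ← dist_eq_norm]
      have : dist (IccExtend hab z r) (IccExtend hab w r) ≤ dist z w :=
        ContinuousMap.dist_apply_le_dist _
      calc L * (Real.exp (2 * L * (r - a)) * dist (IccExtend hab z r) (IccExtend hab w r))
          ≤ L * (Real.exp (2 * L * (r - a)) * dist z w) := by gcongr
        _ = _ := by ring
    change dist (Real.exp (-(2 * L * (s - a))) • (x + ∫ r in a..s, G (lift z r) r))
      (Real.exp (-(2 * L * (s - a))) • (x + ∫ r in a..s, G (lift w r) r)) ≤ _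
    rw [dist_eq_norm, ← smul_sub, add_sub_add_left_eq_sub, norm_smul,
      Real.norm_of_nonneg (Real.exp_pos _).le]
    have h1 : Real.exp (-(2 * L * (s - a))) * Real.exp (2 * L * (s - a)) = 1 := by
      rw [← Real.exp_add]; simp
    calc _ ≤ Real.exp (-(2 * L * (s - a))) *
          (L * dist z w * ((Real.exp (2 * L * (s - a)) - 1) / (2 * L))) := by gcongr
      _ = (Real.exp (-(2 * L * (s - a))) * Real.exp (2 * L * (s - a))
            - Real.exp (-(2 * L * (s - a)))) * dist z w / 2 := by field_simp
      _ ≤ ((1 / 2 : NNReal) : ℝ) * dist z w := by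
        rw [h1]
        push_cast
        nlinarith [Real.exp_pos (-(2 * L * (s - a))), dist_nonneg (x := z) (y := w)]
  obtain ⟨z, hz⟩ : ∃ z, Φ z = z := ⟨_, hΦ.fixedPoint_isFixedPt⟩
  refine ⟨lift z, hlift z, fun s hs => ?_⟩
  have h1 : IccExtend hab z s =
      Real.exp (-(2 * L * (s - a))) • (x + ∫ r in a..s, G (lift z r) r) := by
    rw [IccExtend_of_mem _ _ hs]
    exact (DFunLike.congr_fun hz ⟨s, hs⟩).symm
  change Real.exp (2 * L * (s - a)) • IccExtend hab z s = _
  rw [h1, smul_smul, ← Real.exp_add]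
  simp

/-- A continuous function of the state, the control and the time is integrable along a continuous
state and a measurable control, as soon as it is bounded there. -/
theorem intervalIntegrable_comp {X A H : Type*} [TopologicalSpace X] [MeasurableSpace X]
    [BorelSpace X] [SecondCountableTopology X] [TopologicalSpace A] [MeasurableSpace A]
    [BorelSpace A] [SecondCountableTopology A] [NormedAddCommGroup H] [SecondCountableTopology H]
    {F : X × A × ℝ → H} (hF : Continuous F) {y : ℝ → X} {α : ℝ → A} {a b M : ℝ} (hab : a ≤ b)
    (hy : ContinuousOn y (Icc a b)) (hα : Measurable α) {g : ℝ → H}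
    (hg : ∀ r ∈ Icc a b, g r = F (y r, α r, r)) (hM : ∀ r ∈ Icc a b, ‖g r‖ ≤ M) :
    IntervalIntegrable g volume a b := by
  borelize H
  have hy' : Continuous (IccExtend hab ((Icc a b).domRestrict y)) :=
    (continuousOn_iff_continuous_domRestrict.1 hy).Icc_extend'
  have hm : StronglyMeasurable
      fun r => F (IccExtend hab ((Icc a b).domRestrict y) r, α r, r) :=
    (hF.measurable.comp (hy'.measurable.prodMk (hα.prodMk measurable_id))).stronglyMeasurable
  have hsub : Ioc a b ⊆ Icc a b := Ioc_subset_Icc_self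
  rw [intervalIntegrable_iff_integrableOn_Ioc_of_le hab]
  refine (integrableOn_const (C := M) (by simp)).mono' ?_ ?_
  · refine hm.aestronglyMeasurable.congr ?_
    filter_upwards [ae_restrict_mem measurableSet_Ioc] with r hr
    rw [hg r (hsub hr), IccExtend_of_mem _ _ (hsub hr)]
    rfl
  · filter_upwards [ae_restrict_mem measurableSet_Ioc] with r hr using hM r (hsub hr)

namespace Problem

variable {d m N : ℕ} {P : Problem d m N}

/-! ### Trajectories -/

theorem Standing.intervalIntegrable_f (hP : P.Standing) (p : Fin N → Bool) {α : ℝ → P.A}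
    {y : ℝ → EuclideanSpace ℝ (Fin d)} {t t' a b : ℝ} (hα : Measurable α)
    (hy : ContinuousOn y (Icc t t')) (ha : a ∈ Icc t t') (hb : b ∈ Icc t t') :
    IntervalIntegrable (fun r => P.f (y r) (α r) p) volume a b := by
  obtain ⟨M, hM⟩ := hP.f_bounded
  have hF : Continuous fun z : EuclideanSpace ℝ (Fin d) × P.A × ℝ => P.f z.1 z.2.1 p :=
    hP.f_continuous.comp (by fun_prop : Continuous
      fun z : EuclideanSpace ℝ (Fin d) × P.A × ℝ => (z.1, z.2.1, p))
  have h := intervalIntegrable_comp hF (ha.1.trans ha.2) hy hα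
    (g := fun r => P.f (y r) (α r) p) (fun _ _ => rfl) (fun r _ => hM _ _ _)
  refine h.mono_set ?_
  rw [uIcc_of_le (ha.1.trans ha.2)]
  exact uIcc_subset_Icc ha hb

theorem norm_integral_f_le {M : ℝ} (hM : ∀ x a p, ‖P.f x a p‖ ≤ M)
    (p : Fin N → Bool) (α : ℝ → P.A) (y : ℝ → EuclideanSpace ℝ (Fin d)) (a b : ℝ) :
    ‖∫ r in a..b, P.f (y r) (α r) p‖ ≤ M * |b - a| :=
  intervalIntegral.norm_integral_le_of_norm_le_const fun _ _ => hM _ _ _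

/-- Trajectories are the continuous solutions of the integral equation. -/
theorem Standing.isTrajectory_iff (hP : P.Standing) {p : Fin N → Bool}
    {x : EuclideanSpace ℝ (Fin d)} {t : ℝ} {α : ℝ → P.A} {y : ℝ → EuclideanSpace ℝ (Fin d)}
    (hα : Measurable α) (ht : t ≤ P.T) :
    P.IsTrajectory p x t α y ↔ ContinuousOn y (Icc t P.T) ∧
      ∀ s ∈ Icc t P.T, y s = x + ∫ r in t..s, P.f (y r) (α r) p := by
  obtain ⟨M, hM⟩ := hP.f_bounded
  -- the primitive of the velocity is Lipschitz, hence absolutely continuous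
  have hlip : ContinuousOn y (Icc t P.T) → LipschitzOnWith M.toNNReal
      (fun s => ∫ r in t..s, P.f (y r) (α r) p) (uIcc t P.T) := fun hy => by
    refine LipschitzOnWith.of_dist_le_mul fun s hs r hr => ?_
    rw [uIcc_of_le ht] at hs hr
    have ht' : t ∈ Icc t P.T := left_mem_Icc.2 ht
    rw [dist_eq_norm, intervalIntegral.integral_interval_sub_left
      (hP.intervalIntegrable_f p hα hy ht' hs) (hP.intervalIntegrable_f p hα hy ht' hr),
      Real.dist_eq]
    exact (norm_integral_f_le hM p α y r s).trans
      (mul_le_mul_of_nonneg_right (Real.le_coe_toNNReal M) (abs_nonneg _))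
  have hder : ContinuousOn y (Icc t P.T) → ∀ᵐ s : ℝ, s ∈ Icc t P.T →
      HasDerivAt (fun s => ∫ r in t..s, P.f (y r) (α r) p) (P.f (y s) (α s) p) s := fun hy => by
    have h := (hP.intervalIntegrable_f p hα hy (left_mem_Icc.2 ht)
      (right_mem_Icc.2 ht)).ae_hasDerivAt_integral
    rw [uIcc_of_le ht] at h
    filter_upwards [h] with s hs hsm using hs hsm t (left_mem_Icc.2 ht)
  have hne : ∀ c : ℝ, ∀ᵐ s : ℝ, s ≠ c := fun c => by simp [ae_iff, measure_singleton]
  constructor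
  · rintro ⟨h0, hyac, hyd⟩
    have hy : ContinuousOn y (Icc t P.T) := uIcc_of_le ht ▸ hyac.continuousOn
    refine ⟨hy, fun s hs => ?_⟩
    -- `y` and the primitive of its velocity differ by a constant
    have hdiff := hyac.sub (hlip hy).absolutelyContinuousOnInterval
    obtain ⟨c, hc⟩ := hdiff.const_of_ae_hasDerivAt_zero
      (by
        rw [uIcc_of_le ht]
        filter_upwards [hyd, hder hy, hne t] with s h1 h2 h3 hs
        simpa using (h1 ⟨lt_of_le_of_ne hs.1 h3.symm, hs.2⟩).sub (h2 hs))
    rw [uIcc_of_le ht] at hc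
    have h1 := hc t (left_mem_Icc.2 ht)
    have h2 := hc s hs
    simp only [Pi.sub_apply, intervalIntegral.integral_same, sub_zero, h0] at h1 h2
    rw [h1, ← h2]
    abel
  · rintro ⟨hy, h⟩
    refine ⟨by simpa using h t (left_mem_Icc.2 ht), ?_, ?_⟩
    · refine LipschitzOnWith.absolutelyContinuousOnInterval (K := M.toNNReal) ?_
      refine LipschitzOnWith.of_dist_le_mul fun s hs r hr => ?_
      have h1 := (hlip hy).dist_le_mul s hs r hr
      rw [uIcc_of_le ht] at hs hr
      rwa [h s hs, h r hr, dist_add_left]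
    · filter_upwards [hder hy, hne P.T] with s h1 h2 hs
      have h3 := (h1 ⟨hs.1.le, hs.2⟩).const_add x
      refine h3.congr_of_eventuallyEq ?_
      filter_upwards [Ioo_mem_nhds hs.1 (lt_of_le_of_ne hs.2 h2)] with r hr
      exact h r ⟨hr.1.le, hr.2.le⟩

theorem Standing.exists_isTrajectory (hP : P.Standing) (p : Fin N → Bool)
    (x : EuclideanSpace ℝ (Fin d)) {t : ℝ} (ht : t ≤ P.T) {α : ℝ → P.A} (hα : Measurable α) :
    ∃ y, P.IsTrajectory p x t α y := by
  obtain ⟨M, hM⟩ := hP.f_bounded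
  obtain ⟨L, hL, hLip⟩ := hP.f_lipschitz
  have hF : Continuous fun z : EuclideanSpace ℝ (Fin d) × P.A => P.f z.1 z.2 p :=
    hP.f_continuous.comp (by fun_prop : Continuous
      fun z : EuclideanSpace ℝ (Fin d) × P.A => (z.1, z.2, p))
  obtain ⟨y, hy, hy'⟩ := exists_integral_solution (G := fun x s => P.f x (α s) p) hL
    (fun x s => hM _ _ _) (fun x y s => hLip _ _ _ _)
    (fun z hz => (hF.measurable.comp (hz.measurable.prodMk hα)).stronglyMeasurable) x ht
  exact ⟨y, (hP.isTrajectory_iff hα ht).2 ⟨hy.continuousOn, hy'⟩⟩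

namespace IsTrajectory

variable {p : Fin N → Bool} {x x' : EuclideanSpace ℝ (Fin d)} {t t' : ℝ} {α α' : ℝ → P.A}
  {y y' : ℝ → EuclideanSpace ℝ (Fin d)}

theorem continuousOn (h : P.IsTrajectory p x t α y) (ht : t ≤ P.T) : ContinuousOn y (Icc t P.T) :=
  uIcc_of_le ht ▸ h.2.1.continuousOn

theorem sub_eq_integral (h : P.IsTrajectory p x t α y) (hP : P.Standing) (hα : Measurable α)
    {r s : ℝ} (hr : r ∈ Icc t P.T) (hs : s ∈ Icc t P.T) :
    y s - y r = ∫ q in r..s, P.f (y q) (α q) p := by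
  have ht : t ≤ P.T := hr.1.trans hr.2
  obtain ⟨hy, h'⟩ := (hP.isTrajectory_iff hα ht).1 h
  have ht' : t ∈ Icc t P.T := left_mem_Icc.2 ht
  rw [h' s hs, h' r hr, add_sub_add_left_eq_sub, intervalIntegral.integral_interval_sub_left
    (hP.intervalIntegrable_f p hα hy ht' hs) (hP.intervalIntegrable_f p hα hy ht' hr)]

theorem norm_sub_le (h : P.IsTrajectory p x t α y) (hP : P.Standing) (hα : Measurable α)
    {M : ℝ} (hM : ∀ x a p, ‖P.f x a p‖ ≤ M) {s : ℝ} (hs : s ∈ Icc t P.T) :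
    ‖y s - x‖ ≤ M * (s - t) := by
  rw [← h.1, h.sub_eq_integral hP hα (left_mem_Icc.2 (hs.1.trans hs.2)) hs]
  simpa [abs_of_nonneg (sub_nonneg.2 hs.1)] using norm_integral_f_le hM p α y t s

theorem tail (h : P.IsTrajectory p x t α y) (ht' : t' ∈ Icc t P.T) :
    P.IsTrajectory p (y t') t' α y := by
  refine ⟨rfl, h.2.1.mono ?_, ?_⟩
  · rw [uIcc_of_le ht'.2, uIcc_of_le (ht'.1.trans ht'.2)]
    exact Icc_subset_Icc_left ht'.1
  · filter_upwards [h.2.2] with s hs hs' using hs ⟨ht'.1.trans_lt hs'.1, hs'.2⟩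

/-- Following `α` up to the time `t'` and `α'` afterwards gives the concatenated trajectory. -/
theorem concat (h : P.IsTrajectory p x t α y) (hP : P.Standing) (hα : Measurable α)
    (ht' : t' ∈ Icc t P.T) (h' : P.IsTrajectory p (y t') t' α' y') (hα' : Measurable α') :
    P.IsTrajectory p x t (fun s => if s ≤ t' then α s else α' s)
      (fun s => if s ≤ t' then y s else y' s) := by
  have ht : t ≤ P.T := ht'.1.trans ht'.2
  have hα'' : Measurable fun s => if s ≤ t' then α s else α' s :=
    hα.ite measurableSet_Iic hα'
  obtain ⟨hy, hyi⟩ := (hP.isTrajectory_iff hα ht).1 h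
  obtain ⟨hy', hyi'⟩ := (hP.isTrajectory_iff hα' ht'.2).1 h'
  have hcont : ContinuousOn (fun s => if s ≤ t' then y s else y' s) (Icc t P.T) := by
    have h1 : ContinuousOn (fun s => y (min s t') + y' (max s t') - y t') (Icc t P.T) := by
      refine ((hy.comp (by fun_prop) fun s hs => ?_).add
        (hy'.comp (by fun_prop) fun s hs => ?_)).sub continuousOn_const
      · exact ⟨le_min hs.1 ht'.1, (min_le_right _ _).trans ht'.2⟩
      · exact ⟨le_max_right _ _, max_le hs.2 ht'.2⟩
    -- the pieces are glued through clamped times, which makes continuity at `t'` automatic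
    refine h1.congr fun s _ => ?_
    by_cases hs : s ≤ t'
    · simp [hs, h'.1]
    · simp [hs, le_of_not_ge hs]
  refine (hP.isTrajectory_iff hα'' ht).2 ⟨hcont, fun s hs => ?_⟩
  have hfst : ∀ s ≤ t', t ≤ s → ∫ r in t..s, P.f (if r ≤ t' then y r else y' r)
      (if r ≤ t' then α r else α' r) p = ∫ r in t..s, P.f (y r) (α r) p := fun s hs hts => by
    refine intervalIntegral.integral_congr fun r hr => ?_
    rw [uIcc_of_le hts] at hr
    simp [hr.2.trans hs]
  by_cases hst : s ≤ t'
  · rw [hfst s hst hs.1]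
    simpa [hst] using hyi s hs
  · have hst' : t' ≤ s := le_of_not_ge hst
    have hsnd : ∫ r in t'..s, P.f (if r ≤ t' then y r else y' r)
        (if r ≤ t' then α r else α' r) p = ∫ r in t'..s, P.f (y' r) (α' r) p := by
      refine intervalIntegral.integral_congr_ae (Eventually.of_forall fun r hr => ?_)
      rw [uIoc_of_le hst'] at hr
      simp [not_le.2 hr.1]
    rw [← intervalIntegral.integral_add_adjacent_intervals
      (hP.intervalIntegrable_f p hα'' hcont (left_mem_Icc.2 ht) ht')
      (hP.intervalIntegrable_f p hα'' hcont ht' hs), hfst t' le_rfl ht'.1, hsnd, ← add_assoc,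
      ← hyi t' ht', ← hyi' s ⟨hst', hs.2⟩]
    simp [hst]

/-- Lipschitz dependence of the trajectory on its initial point. -/
theorem norm_sub_le_mul_exp (h : P.IsTrajectory p x t α y) (h' : P.IsTrajectory p x' t α y')
    (hP : P.Standing) (hα : Measurable α) {L : ℝ} (hL : 0 < L)
    (hLip : ∀ x y a p, ‖P.f x a p - P.f y a p‖ ≤ L * ‖x - y‖) {s : ℝ} (hs : s ∈ Icc t P.T) :
    ‖y s - y' s‖ ≤ ‖x - x'‖ * Real.exp (L * (s - t)) := by
  have ht : t ≤ P.T := hs.1.trans hs.2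
  obtain ⟨hy, hyi⟩ := (hP.isTrajectory_iff hα ht).1 h
  obtain ⟨hy', hyi'⟩ := (hP.isTrajectory_iff hα ht).1 h'
  have hu : ContinuousOn (fun s => ‖y s - y' s‖) (Icc t P.T) := (hy.sub hy').norm
  refine le_mul_exp_of_le_add_integral_of_continuousOn hL hu (fun _ _ => norm_nonneg _)
    (fun q hq => ?_) s hs
  have ht' : t ∈ Icc t P.T := left_mem_Icc.2 ht
  rw [hyi q hq, hyi' q hq, add_sub_add_comm, ← intervalIntegral.integral_sub
    (hP.intervalIntegrable_f p hα hy ht' hq) (hP.intervalIntegrable_f p hα hy' ht' hq),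
    ← intervalIntegral.integral_const_mul]
  refine (norm_add_le _ _).trans (add_le_add_right ?_ _)
  refine intervalIntegral.norm_integral_le_of_norm_le hq.1
    (Eventually.of_forall fun r _ => hLip _ _ _ _) ?_
  refine (ContinuousOn.intervalIntegrable ?_).const_mul L
  rw [uIcc_of_le hq.1]
  exact hu.mono (Icc_subset_Icc_right hq.2)

end IsTrajectory

end Problem

/-! ### Costs and the dynamic programming principle -/

theorem pbar_mem_switchSet {N : ℕ} {p : Fin N → Bool} (hp : p ≠ pbar N) :
    pbar N ∈ switchSet p := by
  refine ⟨fun _ _ => rfl, ?_⟩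
  by_contra! h
  exact hp (funext fun i => by
    have := h i
    simp only [pbar] at this ⊢
    by_contra hi
    exact this (by simpa using hi) rfl)

namespace Problem

variable {d m N : ℕ} {P : Problem d m N}

/-- The cost of following the trajectory `y` from the time `t` to the time `τ` and of then
switching to the cheapest admissible discrete state. -/
def stoppingCost (P : Problem d m N) (p : Fin N → Bool) (t τ : ℝ) (α : ℝ → P.A)
    (y : ℝ → EuclideanSpace ℝ (Fin d)) : ℝ :=
  P.runningCost p t τ α y + Real.exp (-P.lam * (τ - t)) * P.psi p (y τ) τ

theorem psi_le {p p' : Fin N → Bool} (hp' : p' ∈ switchSet p) (x : EuclideanSpace ℝ (Fin d))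
    (t : ℝ) : P.psi p x t ≤ P.C x p p' + P.value p' x t :=
  ciInf_le (Set.finite_range _).bddBelow (⟨p', hp'⟩ : switchSet p)

theorem exists_psi_eq {p : Fin N → Bool} (hp : p ≠ pbar N) (x : EuclideanSpace ℝ (Fin d))
    (t : ℝ) : ∃ p' ∈ switchSet p, P.psi p x t = P.C x p p' + P.value p' x t := by
  have : Nonempty (switchSet p) := ⟨⟨_, pbar_mem_switchSet hp⟩⟩
  obtain ⟨p', h⟩ := exists_eq_ciInf_of_finite
    (f := fun p' : switchSet p => P.C x p p' + P.value p' x t)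
  exact ⟨p', p'.2, h.symm⟩

theorem Standing.intervalIntegrable_l (hP : P.Standing) (p : Fin N → Bool) {α : ℝ → P.A}
    {y : ℝ → EuclideanSpace ℝ (Fin d)} {t a b : ℝ} (hα : Measurable α) (ht : 0 ≤ t)
    (hy : ContinuousOn y (Icc t P.T)) (ha : a ∈ Icc t P.T) (hb : b ∈ Icc t P.T) :
    IntervalIntegrable (fun r => P.l (y r) (α r) p r) volume a b := by
  obtain ⟨M, hM⟩ := hP.l_bounded
  have hF : Continuous fun z : EuclideanSpace ℝ (Fin d) × P.A × ℝ =>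
      P.l z.1 z.2.1 p (projIcc 0 P.T hP.T_pos.le z.2.2) :=
    hP.l_continuous.comp_continuous (f := fun z : EuclideanSpace ℝ (Fin d) × P.A × ℝ =>
      (z.1, z.2.1, p, (projIcc 0 P.T hP.T_pos.le z.2.2 : ℝ))) (by fun_prop)
      fun z => (projIcc 0 P.T hP.T_pos.le z.2.2).2
  have hsub : ∀ r ∈ Icc t P.T, r ∈ Icc 0 P.T := fun r hr => ⟨ht.trans hr.1, hr.2⟩
  have h := intervalIntegrable_comp hF (ha.1.trans ha.2) hy hα
    (g := fun r => P.l (y r) (α r) p r) (M := M)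
    (fun r hr => by rw [projIcc_of_mem hP.T_pos.le (hsub r hr)]) (fun r hr => by
      rw [Real.norm_of_nonneg (hP.l_nonneg _ _ _ _ (hsub r hr))]
      exact hM _ _ _ _ (hsub r hr))
  refine h.mono_set ?_
  rw [uIcc_of_le (ha.1.trans ha.2)]
  exact uIcc_subset_Icc ha hb

theorem Standing.intervalIntegrable_runningCost (hP : P.Standing) (p : Fin N → Bool)
    {α : ℝ → P.A} {y : ℝ → EuclideanSpace ℝ (Fin d)} {t a b : ℝ} (hα : Measurable α)
    (ht : 0 ≤ t) (hy : ContinuousOn y (Icc t P.T)) (ha : a ∈ Icc t P.T) (hb : b ∈ Icc t P.T)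
    (c : ℝ) :
    IntervalIntegrable (fun r => Real.exp (-P.lam * (r - c)) * P.l (y r) (α r) p r)
      volume a b :=
  (hP.intervalIntegrable_l p hα ht hy ha hb).continuousOn_mul (by fun_prop)

theorem Standing.exp_le_one (hP : P.Standing) {s t : ℝ} (h : t ≤ s) :
    Real.exp (-P.lam * (s - t)) ≤ 1 := by
  rw [Real.exp_le_one_iff]
  nlinarith [hP.lam_nonneg, sub_nonneg.2 h]

theorem Standing.runningCost_nonneg (hP : P.Standing) (p : Fin N → Bool) (α : ℝ → P.A)
    (y : ℝ → EuclideanSpace ℝ (Fin d)) {t τ : ℝ} (ht : 0 ≤ t) (hτ : τ ∈ Icc t P.T) :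
    0 ≤ P.runningCost p t τ α y :=
  intervalIntegral.integral_nonneg hτ.1 fun _ hs => mul_nonneg (Real.exp_pos _).le
    (hP.l_nonneg _ _ _ _ ⟨ht.trans hs.1, hs.2.trans hτ.2⟩)

theorem Standing.runningCost_le (hP : P.Standing) {M : ℝ}
    (hM : ∀ x a p, ∀ t ∈ Icc 0 P.T, P.l x a p t ≤ M) (p : Fin N → Bool) (α : ℝ → P.A)
    (y : ℝ → EuclideanSpace ℝ (Fin d)) {t τ : ℝ} (ht : 0 ≤ t) (hτ : τ ∈ Icc t P.T) :
    P.runningCost p t τ α y ≤ M * (τ - t) := by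
  have h := intervalIntegral.norm_integral_le_of_norm_le_const (a := t) (b := τ) (C := M)
    (f := fun s => Real.exp (-P.lam * (s - t)) * P.l (y s) (α s) p s) fun s hs => by
      rw [uIoc_of_le hτ.1] at hs
      have hs' : s ∈ Icc 0 P.T := ⟨ht.trans hs.1.le, hs.2.trans hτ.2⟩
      have h0 := hP.l_nonneg (y s) (α s) p s hs'
      rw [Real.norm_of_nonneg (mul_nonneg (Real.exp_pos _).le h0)]
      exact (mul_le_of_le_one_left h0 (hP.exp_le_one hs.1.le)).trans (hM _ _ _ _ hs')
  rw [abs_of_nonneg (sub_nonneg.2 hτ.1)] at h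
  exact (le_abs_self _).trans h

theorem Standing.runningCost_split (hP : P.Standing) (p : Fin N → Bool)
    {α : ℝ → P.A} {y : ℝ → EuclideanSpace ℝ (Fin d)} {t t' τ : ℝ} (hα : Measurable α)
    (ht : 0 ≤ t) (hy : ContinuousOn y (Icc t P.T)) (ht' : t' ∈ Icc t τ) (hτ : τ ≤ P.T) :
    P.runningCost p t τ α y =
      P.runningCost p t t' α y + Real.exp (-P.lam * (t' - t)) * P.runningCost p t' τ α y := by
  have h1 : t ∈ Icc t P.T := ⟨le_rfl, ht'.1.trans (ht'.2.trans hτ)⟩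
  have h2 : t' ∈ Icc t P.T := ⟨ht'.1, ht'.2.trans hτ⟩
  have h3 : τ ∈ Icc t P.T := ⟨ht'.1.trans ht'.2, hτ⟩
  unfold runningCost
  rw [← intervalIntegral.integral_add_adjacent_intervals
    (hP.intervalIntegrable_runningCost p hα ht hy h1 h2 t)
    (hP.intervalIntegrable_runningCost p hα ht hy h2 h3 t),
    ← intervalIntegral.integral_const_mul]
  congr 2
  funext s
  rw [← mul_assoc, ← Real.exp_add]
  ring_nf

theorem Standing.stoppingCost_split (hP : P.Standing) (p : Fin N → Bool)
    {α : ℝ → P.A} {y : ℝ → EuclideanSpace ℝ (Fin d)} {t t' τ : ℝ} (hα : Measurable α)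
    (ht : 0 ≤ t) (hy : ContinuousOn y (Icc t P.T)) (ht' : t' ∈ Icc t τ) (hτ : τ ≤ P.T) :
    P.stoppingCost p t τ α y =
      P.runningCost p t t' α y + Real.exp (-P.lam * (t' - t)) * P.stoppingCost p t' τ α y := by
  unfold stoppingCost
  rw [hP.runningCost_split p hα ht hy ht' hτ, mul_add, ← mul_assoc, ← Real.exp_add, add_assoc]
  ring_nf

theorem runningCost_congr {p : Fin N → Bool} {α α' : ℝ → P.A}
    {y y' : ℝ → EuclideanSpace ℝ (Fin d)} {t τ : ℝ} (h : t ≤ τ)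
    (hα : ∀ s ∈ Ioc t τ, α s = α' s) (hy : ∀ s ∈ Ioc t τ, y s = y' s) :
    P.runningCost p t τ α y = P.runningCost p t τ α' y' := by
  refine intervalIntegral.integral_congr_ae (Eventually.of_forall fun s hs => ?_)
  rw [uIoc_of_le h] at hs
  rw [hα s hs, hy s hs]

theorem value_pbar (x : EuclideanSpace ℝ (Fin d)) (t : ℝ) : P.value (pbar N) x t = 0 := by
  rw [value, if_pos rfl]

theorem Standing.value_nonneg (hP : P.Standing) (p : Fin N → Bool)
    (x : EuclideanSpace ℝ (Fin d)) {t : ℝ} (ht : 0 ≤ t) : 0 ≤ P.value p x t := by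
  induction hn : zeros p using Nat.strong_induction_on generalizing p x t with
  | _ n ih =>
    rw [value]
    split_ifs with hp
    · exact le_rfl
    · refine Real.sInf_nonneg ?_
      rintro c ⟨α, y, τ, p', hp', -, -, hτ, rfl⟩
      exact add_nonneg (hP.runningCost_nonneg p α y ht hτ) (mul_nonneg (Real.exp_pos _).le
        (add_nonneg (hP.C_nonneg _ _ _)
          (ih _ (hn ▸ zeros_lt hp') p' _ (ht.trans hτ.1) rfl)))

theorem Standing.psi_nonneg (hP : P.Standing) (p : Fin N → Bool)
    (x : EuclideanSpace ℝ (Fin d)) {t : ℝ} (ht : 0 ≤ t) : 0 ≤ P.psi p x t :=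
  Real.iInf_nonneg fun _ => add_nonneg (hP.C_nonneg _ _ _) (hP.value_nonneg _ _ ht)

theorem Standing.value_le_stoppingCost (hP : P.Standing) {p : Fin N → Bool} (hp : p ≠ pbar N)
    {x : EuclideanSpace ℝ (Fin d)} {t τ : ℝ} {α : ℝ → P.A}
    {y : ℝ → EuclideanSpace ℝ (Fin d)} (ht : 0 ≤ t) (hα : Measurable α)
    (hy : P.IsTrajectory p x t α y) (hτ : τ ∈ Icc t P.T) :
    P.value p x t ≤ P.stoppingCost p t τ α y := by
  obtain ⟨p', hp', h⟩ := P.exists_psi_eq hp (y τ) τ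
  rw [value, if_neg hp, stoppingCost, h]
  refine csInf_le ⟨0, ?_⟩ ⟨α, y, τ, p', hp', hα, hy, hτ, rfl⟩
  rintro c ⟨α, y, τ, p', hp', -, -, hτ, rfl⟩
  exact add_nonneg (hP.runningCost_nonneg p α y ht hτ) (mul_nonneg (Real.exp_pos _).le
    (add_nonneg (hP.C_nonneg _ _ _) (hP.value_nonneg _ _ (ht.trans hτ.1))))

theorem Standing.exists_measurable_control (hP : P.Standing) :
    ∃ α : ℝ → P.A, Measurable α :=
  let ⟨a, ha⟩ := hP.A_nonempty
  ⟨fun _ => ⟨a, ha⟩, measurable_const⟩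

theorem Standing.exists_stoppingCost_lt (hP : P.Standing) {p : Fin N → Bool} (hp : p ≠ pbar N)
    (x : EuclideanSpace ℝ (Fin d)) {t : ℝ} (ht : t ≤ P.T) {ε : ℝ} (hε : 0 < ε) :
    ∃ (α : ℝ → P.A) (y : ℝ → EuclideanSpace ℝ (Fin d)) (τ : ℝ), Measurable α ∧
      P.IsTrajectory p x t α y ∧ τ ∈ Icc t P.T ∧
      P.stoppingCost p t τ α y < P.value p x t + ε := by
  obtain ⟨α₀, hα₀⟩ := hP.exists_measurable_control
  obtain ⟨y₀, hy₀⟩ := hP.exists_isTrajectory p x ht hα₀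
  rw [value, if_neg hp]
  obtain ⟨c, ⟨α, y, τ, p', hp', hα, hy, hτ, rfl⟩, hc⟩ := Real.lt_sInf_add_pos
    (s := {c : ℝ | ∃ (α : ℝ → P.A) (y : ℝ → EuclideanSpace ℝ (Fin d)) (τ : ℝ)
      (p' : Fin N → Bool) (_ : p' ∈ switchSet p),
      Measurable α ∧ P.IsTrajectory p x t α y ∧ τ ∈ Icc t P.T ∧
      c = P.runningCost p t τ α y
        + Real.exp (-P.lam * (τ - t)) * (P.C (y τ) p p' + P.value p' (y τ) τ)})
    ⟨_, α₀, y₀, t, pbar N, pbar_mem_switchSet hp, hα₀, hy₀, left_mem_Icc.2 ht, rfl⟩ hε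
  refine ⟨α, y, τ, hα, hy, hτ, lt_of_le_of_lt ?_ hc⟩
  unfold stoppingCost
  gcongr
  exact psi_le hp' _ _

theorem Standing.value_le_psi (hP : P.Standing) {p : Fin N → Bool} (hp : p ≠ pbar N)
    (x : EuclideanSpace ℝ (Fin d)) {t : ℝ} (ht : t ∈ Icc 0 P.T) :
    P.value p x t ≤ P.psi p x t := by
  obtain ⟨α, hα⟩ := hP.exists_measurable_control
  obtain ⟨y, hy⟩ := hP.exists_isTrajectory p x ht.2 hα
  have h := hP.value_le_stoppingCost hp ht.1 hα hy (left_mem_Icc.2 ht.2)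
  simpa [stoppingCost, runningCost, hy.1] using h

theorem Standing.value_terminal (hP : P.Standing) {p : Fin N → Bool} (hp : p ≠ pbar N)
    (x : EuclideanSpace ℝ (Fin d)) : P.value p x P.T = P.psi p x P.T := by
  refine le_antisymm (hP.value_le_psi hp x (right_mem_Icc.2 hP.T_pos.le))
    (le_of_forall_pos_le_add fun ε hε => ?_)
  obtain ⟨α, y, τ, hα, hy, hτ, h⟩ := hP.exists_stoppingCost_lt hp x le_rfl hε
  obtain rfl : τ = P.T := le_antisymm hτ.2 hτ.1
  refine le_trans ?_ h.le
  simp [stoppingCost, runningCost, hy.1]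

/-- The suboptimality half of the dynamic programming principle. -/
theorem Standing.value_le_runningCost_add (hP : P.Standing) {p : Fin N → Bool}
    (hp : p ≠ pbar N) {x : EuclideanSpace ℝ (Fin d)} {t t' : ℝ} {α : ℝ → P.A}
    {y : ℝ → EuclideanSpace ℝ (Fin d)} (ht : 0 ≤ t) (hα : Measurable α)
    (hy : P.IsTrajectory p x t α y) (ht' : t' ∈ Icc t P.T) :
    P.value p x t ≤
      P.runningCost p t t' α y + Real.exp (-P.lam * (t' - t)) * P.value p (y t') t' := by
  refine le_of_forall_pos_le_add fun ε hε => ?_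
  obtain ⟨α', y', τ, hα', hy', hτ, h⟩ := hP.exists_stoppingCost_lt hp (y t') ht'.2 hε
  have hc := hy.concat hP hα ht' hy' hα'
  have hα'' : Measurable fun s => if s ≤ t' then α s else α' s := hα.ite measurableSet_Iic hα'
  have h1 := hP.value_le_stoppingCost hp ht hα'' hc ⟨ht'.1.trans hτ.1, hτ.2⟩
  rw [hP.stoppingCost_split p hα'' ht (hc.continuousOn (ht'.1.trans ht'.2)) ⟨ht'.1, hτ.1⟩ hτ.2,
    runningCost_congr (α' := α) (y' := y) ht'.1 (fun s hs => by simp [hs.2])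
      (fun s hs => by simp [hs.2])] at h1
  have h2 : P.stoppingCost p t' τ (fun s => if s ≤ t' then α s else α' s)
      (fun s => if s ≤ t' then y s else y' s) = P.stoppingCost p t' τ α' y' := by
    unfold stoppingCost
    rw [runningCost_congr (α' := α') (y' := y') hτ.1 (fun s hs => by simp [hs.1])
      (fun s hs => by simp [hs.1])]
    by_cases hτt : τ ≤ t'
    · obtain rfl : τ = t' := le_antisymm hτt hτ.1
      simp [hy'.1]
    · simp [hτt]
  rw [h2] at h1
  have h3 : Real.exp (-P.lam * (t' - t)) * P.stoppingCost p t' τ α' y' ≤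
      Real.exp (-P.lam * (t' - t)) * P.value p (y t') t' + ε := by
    calc _ ≤ Real.exp (-P.lam * (t' - t)) * (P.value p (y t') t' + ε) := by gcongr
      _ ≤ _ := by
        rw [mul_add]
        gcongr
        exact mul_le_of_le_one_left hε.le (hP.exp_le_one ht'.1)
  linarith

/-- The other half of the dynamic programming principle: a strategy that does not stop before `t'`
costs at least the running cost up to `t'` plus the discounted value at that time. -/
theorem Standing.runningCost_add_le_stoppingCost (hP : P.Standing) {p : Fin N → Bool}
    (hp : p ≠ pbar N) {x : EuclideanSpace ℝ (Fin d)} {t t' τ : ℝ} {α : ℝ → P.A}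
    {y : ℝ → EuclideanSpace ℝ (Fin d)} (ht : 0 ≤ t) (hα : Measurable α)
    (hy : P.IsTrajectory p x t α y) (ht' : t' ∈ Icc t τ) (hτ : τ ≤ P.T) :
    P.runningCost p t t' α y + Real.exp (-P.lam * (t' - t)) * P.value p (y t') t' ≤
      P.stoppingCost p t τ α y := by
  rw [hP.stoppingCost_split p hα ht (hy.continuousOn (ht'.1.trans (ht'.2.trans hτ))) ht' hτ]
  gcongr
  exact hP.value_le_stoppingCost hp (ht.trans ht'.1) hα
    (hy.tail ⟨ht'.1, ht'.2.trans hτ⟩) ⟨ht'.2, hτ⟩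

end Problem

/-! ### Bounded uniform continuity of the value functions -/

/-- The minimum of finitely many uniformly continuous functions is uniformly continuous. -/
theorem uniformContinuousOn_ciInf {X ι : Type*} [PseudoMetricSpace X] [Finite ι] [Nonempty ι]
    {g : ι → X → ℝ} {s : Set X} (hg : ∀ i, UniformContinuousOn (g i) s) :
    UniformContinuousOn (fun x => ⨅ i, g i x) s := by
  have key : ∀ x y ε, (∀ i, dist (g i x) (g i y) < ε) → (⨅ i, g i x) < (⨅ i, g i y) + ε := by
    intro x y ε h
    obtain ⟨i, hi⟩ := exists_eq_ciInf_of_finite (f := fun i => g i y)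
    rw [← hi]
    have h1 : (⨅ i, g i x) ≤ g i x := ciInf_le (Set.finite_range _).bddBelow i
    have h2 := (abs_lt.1 (Real.dist_eq _ _ ▸ h i)).2
    linarith
  rw [Metric.uniformContinuousOn_iff]
  intro ε hε
  have h := fun i => Metric.uniformContinuousOn_iff.1 (hg i) ε hε
  choose δ hδ h using h
  obtain ⟨i₀, hi₀⟩ := Finite.exists_min δ
  refine ⟨δ i₀, hδ i₀, fun x hx y hy hxy => ?_⟩
  have h1 := key x y ε fun i => h i x hx y hy (hxy.trans_le (hi₀ i))
  have h2 := key y x ε fun i => by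
    rw [dist_comm]; exact h i x hx y hy (hxy.trans_le (hi₀ i))
  rw [Real.dist_eq, abs_lt]
  constructor <;> linarith

namespace Problem

variable {d m N : ℕ} {P : Problem d m N}

theorem Standing.uniformContinuous_C (hP : P.Standing) {p p' : Fin N → Bool}
    (hp' : p' ∈ switchSet p) : UniformContinuous fun x => P.C x p p' := by
  rw [Metric.uniformContinuous_iff]
  intro ε hε
  obtain ⟨δ, hδ, h⟩ := hP.C_unifCont ε hε
  exact ⟨δ, hδ, fun {x y} hxy => h x y p p' hp' (dist_eq_norm x y ▸ hxy)⟩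

/-- The stopping cost inherits bounded uniform continuity from the value functions it involves. -/
theorem Standing.isBUC_psi (hP : P.Standing) {p : Fin N → Bool} (hp : p ≠ pbar N)
    (hC : ∃ K : ℝ, ∀ x, ∃ p' ∈ switchSet p, P.C x p p' ≤ K)
    (hV : ∀ p' ∈ switchSet p, P.IsBUC (P.value p')) : P.IsBUC (P.psi p) := by
  have : Nonempty (switchSet p) := ⟨⟨_, pbar_mem_switchSet hp⟩⟩
  constructor
  · obtain ⟨K, hK⟩ := hC
    have hB := fun p' : switchSet p => (hV p' p'.2).1
    choose B hB using hB
    obtain ⟨p₀, hp₀⟩ := Finite.exists_max B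
    refine ⟨K + B p₀, fun x t ht => ?_⟩
    rw [abs_of_nonneg (hP.psi_nonneg p x ht.1)]
    obtain ⟨p', hp', hp'K⟩ := hK x
    have h1 := (abs_le.1 (hB ⟨p', hp'⟩ x t ht)).2
    linarith [psi_le (P := P) hp' x t, hp₀ ⟨p', hp'⟩]
  · refine uniformContinuousOn_ciInf
      (g := fun (p' : switchSet p) (z : EuclideanSpace ℝ (Fin d) × ℝ) =>
        P.C z.1 p p' + P.value p' z.1 z.2) fun p' => ?_
    have h1 := (hP.uniformContinuous_C p'.2).comp
      (uniformContinuous_fst (α := EuclideanSpace ℝ (Fin d)) (β := ℝ))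
    have h2 := (hV p' p'.2).2
    have h3 := h1.uniformContinuousOn (s := univ ×ˢ Icc 0 P.T)
    rw [uniformContinuousOn_iff_restrict] at h2 h3 ⊢
    exact h3.add h2

theorem IsBUC.exists_modulus {u : EuclideanSpace ℝ (Fin d) → ℝ → ℝ} (hu : P.IsBUC u) {ε : ℝ}
    (hε : 0 < ε) : ∃ δ > 0, ∀ x x', ∀ t ∈ Icc 0 P.T, ∀ t' ∈ Icc 0 P.T, ‖x - x'‖ < δ →
      |t - t'| < δ → |u x t - u x' t'| < ε := by
  obtain ⟨δ, hδ, h⟩ := Metric.uniformContinuousOn_iff.1 hu.2 ε hε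
  refine ⟨δ, hδ, fun x x' t ht t' ht' hx htt => ?_⟩
  have := h (x, t) ⟨mem_univ _, ht⟩ (x', t') ⟨mem_univ _, ht'⟩ (by
    rw [Prod.dist_eq, max_lt_iff]
    exact ⟨dist_eq_norm x x' ▸ hx, Real.dist_eq t t' ▸ htt⟩)
  rwa [Real.dist_eq] at this

/-- A function with values in `[0, K]` that is uniformly continuous in `x`, uniformly in `t`, and
in `t`, uniformly in `x`, is bounded and uniformly continuous. -/
theorem isBUC_of_moduli {u : EuclideanSpace ℝ (Fin d) → ℝ → ℝ} {K : ℝ}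
    (hK : ∀ x, ∀ t ∈ Icc 0 P.T, |u x t| ≤ K)
    (hx : ∀ ε > 0, ∃ δ > 0, ∀ x x', ∀ t ∈ Icc 0 P.T, ‖x - x'‖ < δ → u x t ≤ u x' t + ε)
    (ht : ∀ ε > 0, ∃ δ > 0, ∀ x, ∀ t ∈ Icc 0 P.T, ∀ t' ∈ Icc t P.T, t' - t < δ →
      u x t ≤ u x t' + ε ∧ u x t' ≤ u x t + ε) : P.IsBUC u := by
  refine ⟨⟨K, hK⟩, Metric.uniformContinuousOn_iff.2 fun ε hε => ?_⟩
  obtain ⟨δ₁, hδ₁, h1⟩ := hx (ε / 3) (by positivity)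
  obtain ⟨δ₂, hδ₂, h2⟩ := ht (ε / 3) (by positivity)
  have key : ∀ x x', ∀ t ∈ Icc 0 P.T, ∀ t' ∈ Icc 0 P.T, ‖x - x'‖ < δ₁ → |t - t'| < δ₂ →
      u x t ≤ u x' t' + 2 * (ε / 3) := by
    intro x x' t ht t' ht' hxx htt
    have h3 := h1 x x' t ht hxx
    have h4 : u x' t ≤ u x' t' + ε / 3 := by
      rcases le_total t t' with h | h
      · exact (h2 x' t ht t' ⟨h, ht'.2⟩ (by linarith [(abs_lt.1 htt).1])).1
      · exact (h2 x' t' ht' t ⟨h, ht.2⟩ (by linarith [(abs_lt.1 htt).2])).2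
    linarith
  refine ⟨min δ₁ δ₂, lt_min hδ₁ hδ₂, ?_⟩
  rintro ⟨x, t⟩ ⟨-, ht⟩ ⟨x', t'⟩ ⟨-, ht'⟩ hd
  rw [Prod.dist_eq, max_lt_iff, dist_eq_norm, Real.dist_eq] at hd
  have hd1 := hd.1.trans_le (min_le_left _ _)
  have hd2 := hd.2.trans_le (min_le_right _ _)
  have h3 := key x x' t ht t' ht' hd1 hd2
  have h4 := key x' x t' ht' t ht (by rwa [norm_sub_rev]) (by rwa [abs_sub_comm])
  rw [Real.dist_eq, abs_lt]
  dsimp only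
  constructor <;> linarith

theorem Standing.runningCost_le_add (hP : P.Standing) (p : Fin N → Bool) {α : ℝ → P.A}
    {y y' : ℝ → EuclideanSpace ℝ (Fin d)} {t τ c : ℝ} (hα : Measurable α) (ht : 0 ≤ t)
    (hτ : τ ∈ Icc t P.T) (hy : ContinuousOn y (Icc t P.T)) (hy' : ContinuousOn y' (Icc t P.T))
    (hc : 0 ≤ c) (h : ∀ s ∈ Icc t τ, P.l (y s) (α s) p s ≤ P.l (y' s) (α s) p s + c) :
    P.runningCost p t τ α y ≤ P.runningCost p t τ α y' + c * (τ - t) := by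
  have ht' : t ∈ Icc t P.T := left_mem_Icc.2 (hτ.1.trans hτ.2)
  have h1 := hP.intervalIntegrable_runningCost p hα ht hy ht' hτ t
  have h2 := hP.intervalIntegrable_runningCost p hα ht hy' ht' hτ t
  have h3 := intervalIntegral.integral_mono_on hτ.1 h1
    (h2.add (intervalIntegrable_const (c := c))) fun s hs => by
      calc _ ≤ Real.exp (-P.lam * (s - t)) * (P.l (y' s) (α s) p s + c) := by
            gcongr
            exact h s hs
        _ ≤ _ := by
            rw [mul_add]
            gcongr
            exact mul_le_of_le_one_left hc (hP.exp_le_one hs.1)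
  rw [intervalIntegral.integral_add h2 intervalIntegrable_const] at h3
  simpa [runningCost, mul_comm c] using h3

/-- Trajectories with the same control stay close, so the value function inherits the modulus of
continuity in `x` of the running and stopping costs. -/
theorem Standing.value_modulus_space (hP : P.Standing) {p : Fin N → Bool} (hp : p ≠ pbar N)
    (hψ : P.IsBUC (P.psi p)) {ε : ℝ} (hε : 0 < ε) :
    ∃ δ > 0, ∀ x x', ∀ t ∈ Icc 0 P.T, ‖x - x'‖ < δ → P.value p x t ≤ P.value p x' t + ε := by
  obtain ⟨L, hL, hLip⟩ := hP.f_lipschitz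
  have hT := hP.T_pos
  obtain ⟨δ₁, hδ₁, h1⟩ := hP.l_unifCont (ε / (3 * P.T)) (by positivity)
  obtain ⟨δ₂, hδ₂, h2⟩ := hψ.exists_modulus (ε := ε / 3) (by positivity)
  have hE : 0 < Real.exp (L * P.T) := Real.exp_pos _
  refine ⟨min δ₁ δ₂ / Real.exp (L * P.T), div_pos (lt_min hδ₁ hδ₂) hE,
    fun x x' t ht hxx => ?_⟩
  refine le_of_forall_pos_le_add fun ε' hε' => ?_
  obtain ⟨α, y', τ, hα, hy', hτ, hlt⟩ := hP.exists_stoppingCost_lt hp x' ht.2 hε'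
  obtain ⟨y, hy⟩ := hP.exists_isTrajectory p x ht.2 hα
  have hclose : ∀ s ∈ Icc t P.T, ‖y s - y' s‖ < min δ₁ δ₂ := fun s hs => by
    refine (hy.norm_sub_le_mul_exp hy' hP hα hL hLip hs).trans_lt ?_
    calc ‖x - x'‖ * Real.exp (L * (s - t)) ≤ ‖x - x'‖ * Real.exp (L * P.T) := by
          gcongr
          linarith [hs.2, ht.1]
      _ < min δ₁ δ₂ := (lt_div_iff₀ hE).1 hxx
  have hl : P.runningCost p t τ α y ≤ P.runningCost p t τ α y' + ε / (3 * P.T) * (τ - t) := by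
    refine hP.runningCost_le_add p hα ht.1 hτ (hy.continuousOn ht.2) (hy'.continuousOn ht.2)
      (by positivity) fun s hs => ?_
    have := h1 (y s) (y' s) (α s) p s ⟨ht.1.trans hs.1, hs.2.trans hτ.2⟩
      ((hclose s ⟨hs.1, hs.2.trans hτ.2⟩).trans_le (min_le_left _ _))
    linarith [(abs_lt.1 this).2]
  have hτ0 : τ ∈ Icc 0 P.T := ⟨ht.1.trans hτ.1, hτ.2⟩
  have hψ' := (abs_lt.1 (h2 (y τ) (y' τ) τ hτ0 τ hτ0
    ((hclose τ hτ).trans_le (min_le_right _ _)) (by simpa using hδ₂))).2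
  have h3 := hP.value_le_stoppingCost hp ht.1 hα hy hτ
  have h4 : ε / (3 * P.T) * (τ - t) ≤ ε / 3 := by
    calc ε / (3 * P.T) * (τ - t) ≤ ε / (3 * P.T) * P.T := by
          gcongr
          linarith [hτ.2, ht.1]
      _ = ε / 3 := by field_simp
  have h5 : Real.exp (-P.lam * (τ - t)) * P.psi p (y τ) τ ≤
      Real.exp (-P.lam * (τ - t)) * P.psi p (y' τ) τ + ε / 3 := by
    calc _ ≤ Real.exp (-P.lam * (τ - t)) * (P.psi p (y' τ) τ + ε / 3) := by
          gcongr
          linarith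
      _ ≤ _ := by
          rw [mul_add]
          gcongr
          exact mul_le_of_le_one_left (by positivity) (hP.exp_le_one hτ.1)
  simp only [stoppingCost] at h3 hlt
  linarith

theorem Standing.one_sub_exp_mul_le (hP : P.Standing) {s t r K : ℝ} (h : t ≤ s) (hr : 0 ≤ r)
    (hrK : r ≤ K) : r - P.lam * K * (s - t) ≤ Real.exp (-P.lam * (s - t)) * r := by
  have h1 := Real.add_one_le_exp (-P.lam * (s - t))
  have h2 : 0 ≤ P.lam * (s - t) := mul_nonneg hP.lam_nonneg (sub_nonneg.2 h)
  nlinarith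

/-- Modulus of continuity in time of the value function, by dynamic programming between the two
times; a strategy that stops in between is compared with switching at the later time. -/
theorem Standing.value_modulus_time (hP : P.Standing) {p : Fin N → Bool} (hp : p ≠ pbar N)
    (hψ : P.IsBUC (P.psi p)) {ε : ℝ} (hε : 0 < ε) :
    ∃ δ > 0, ∀ x, ∀ t ∈ Icc 0 P.T, ∀ t' ∈ Icc t P.T, t' - t < δ →
      P.value p x t ≤ P.value p x t' + ε ∧ P.value p x t' ≤ P.value p x t + ε := by
  obtain ⟨M, hM⟩ := hP.f_bounded
  obtain ⟨Ml, hMl⟩ := hP.l_bounded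
  obtain ⟨K, hK⟩ := hψ.1
  obtain ⟨δ₁, hδ₁, h1⟩ := hP.value_modulus_space hp hψ (ε := ε / 4) (by positivity)
  obtain ⟨δ₂, hδ₂, h2⟩ := hψ.exists_modulus (ε := ε / 4) (by positivity)
  have hlam := hP.lam_nonneg
  -- the bounds on the data are replaced by positive ones
  set M' := |M| + 1 with hM'
  set Q := |Ml| + P.lam * |K| + 1 with hQ
  have hM'0 : 0 < M' := by positivity
  have hQ0 : 0 < Q := by positivity
  refine ⟨min (min (δ₁ / M') (min δ₂ (δ₂ / M'))) (ε / 4 / Q), by positivity,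
    fun x t ht t' ht' htt => ?_⟩
  obtain ⟨hA, hd⟩ := lt_min_iff.1 htt
  obtain ⟨ha, hB⟩ := lt_min_iff.1 hA
  obtain ⟨hb, hc⟩ := lt_min_iff.1 hB
  rw [lt_div_iff₀ hM'0] at ha hc
  rw [lt_div_iff₀ hQ0] at hd
  have ht0 : t' ∈ Icc 0 P.T := ⟨ht.1.trans ht'.1, ht'.2⟩
  have hge : 0 ≤ t' - t := sub_nonneg.2 ht'.1
  have hMlQ : Ml * (t' - t) < ε / 4 := by
    nlinarith [le_abs_self Ml, mul_nonneg hlam (abs_nonneg K), mul_nonneg hge (abs_nonneg K)]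
  have hKQ : P.lam * |K| * (t' - t) < ε / 4 := by
    nlinarith [abs_nonneg Ml, mul_nonneg hlam (abs_nonneg K)]
  have hspeed : ∀ {α : ℝ → P.A} {y}, Measurable α → P.IsTrajectory p x t α y →
      ∀ s ∈ Icc t t', ‖y s - x‖ ≤ (t' - t) * M' := fun hα hy s hs => by
    refine (hy.norm_sub_le hP hα hM ⟨hs.1, hs.2.trans ht'.2⟩).trans ?_
    have h3 : M * (s - t) ≤ M' * (s - t) := by
      have := sub_nonneg.2 hs.1
      gcongr
      linarith [le_abs_self M]
    have h4 : M' * (s - t) ≤ M' * (t' - t) := by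
      gcongr
      exact hs.2
    linarith
  constructor
  · obtain ⟨α, hα⟩ := hP.exists_measurable_control
    obtain ⟨y, hy⟩ := hP.exists_isTrajectory p x ht.2 hα
    have h3 := hP.value_le_runningCost_add hp ht.1 hα hy ht'
    have h4 := hP.runningCost_le hMl p α y ht.1 ht'
    have h5 := h1 (y t') x t' ht0 ((hspeed hα hy t' ⟨ht'.1, le_rfl⟩).trans_lt ha)
    have h6 := mul_le_of_le_one_left (hP.value_nonneg p (y t') ht0.1) (hP.exp_le_one ht'.1)
    linarith
  · refine le_of_forall_pos_le_add fun ε' hε' => ?_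
    obtain ⟨α, y, τ, hα, hy, hτ, hlt⟩ := hP.exists_stoppingCost_lt hp x ht.2 hε'
    rcases le_total t' τ with h | h
    · have h3 := hP.runningCost_add_le_stoppingCost hp ht.1 hα hy ⟨ht'.1, h⟩ hτ.2
      have h4 := hP.runningCost_nonneg p α y ht.1 ht'
      have h5 := h1 x (y t') t' ht0
        (by rw [norm_sub_rev]; exact (hspeed hα hy t' ⟨ht'.1, le_rfl⟩).trans_lt ha)
      have h6 := hP.one_sub_exp_mul_le (K := |K|) ht'.1 (hP.value_nonneg p (y t') ht0.1)
        ((hP.value_le_psi hp (y t') ht0).trans ((le_abs_self _).trans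
          ((hK _ _ ht0).trans (le_abs_self K))))
      linarith
    · have hτ0 : τ ∈ Icc 0 P.T := ⟨ht.1.trans hτ.1, hτ.2⟩
      have h4 := hP.runningCost_nonneg p α y ht.1 hτ
      have h6 := hP.one_sub_exp_mul_le (K := |K|) hτ.1 (hP.psi_nonneg p (y τ) hτ0.1)
        ((le_abs_self _).trans ((hK _ _ hτ0).trans (le_abs_self K)))
      have h7 : P.lam * |K| * (τ - t) ≤ P.lam * |K| * (t' - t) := by gcongr
      have h8 := h2 (y τ) x τ hτ0 t' ht0 ((hspeed hα hy τ ⟨hτ.1, h⟩).trans_lt hc)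
        (by rw [abs_lt]; constructor <;> linarith [hτ.1])
      have h9 := hP.value_le_psi hp x ht0
      have h10 := (abs_lt.1 h8).1
      simp only [stoppingCost] at hlt
      linarith

/-- Backward induction on the number of unvisited targets. -/
theorem Standing.isBUC_value (hP : P.Standing)
    (hC : ∀ p : Fin N → Bool, p ≠ pbar N → ∃ K : ℝ, ∀ x, ∃ p' ∈ switchSet p, P.C x p p' ≤ K)
    (p : Fin N → Bool) : P.IsBUC (P.value p) := by
  induction hn : zeros p using Nat.strong_induction_on generalizing p with
  | _ n ih =>
    by_cases hp : p = pbar N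
    · subst hp
      refine ⟨⟨0, fun x t _ => by simp [value_pbar]⟩, ?_⟩
      simp only [value_pbar]
      exact uniformContinuous_const.uniformContinuousOn
    · have hψ := hP.isBUC_psi hp (hC p hp) fun p' hp' => ih _ (hn ▸ zeros_lt hp') p' rfl
      obtain ⟨K, hK⟩ := hψ.1
      refine isBUC_of_moduli (K := K) (fun x t ht => ?_)
        (fun ε hε => hP.value_modulus_space hp hψ hε) (fun ε hε => hP.value_modulus_time hp hψ hε)
      rw [abs_of_nonneg (hP.value_nonneg p x ht.1)]
      exact (hP.value_le_psi hp x ht).trans ((le_abs_self _).trans (hK x t ht))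

end Problem

/-! ### The value function solves the obstacle problem -/

/-- First-order expansion of the discount factor, uniformly in the discounted quantity. -/
theorem eventually_one_sub_exp_mul (lam r₀ : ℝ) {ε : ℝ} (hε : 0 < ε) :
    ∃ S : ℝ → Prop, (∀ᶠ r in 𝓝 r₀, S r) ∧ ∀ᶠ h in 𝓝[>] (0 : ℝ), ∀ r, S r →
      |(1 - Real.exp (-lam * h)) * r - lam * h * r₀| ≤ ε * h := by
  have hd : HasDerivAt (fun h : ℝ => 1 - Real.exp (-lam * h)) lam 0 := by
    have h1 : HasDerivAt (fun h : ℝ => -lam * h) (-lam) 0 := by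
      simpa using (hasDerivAt_id (0 : ℝ)).const_mul (-lam)
    simpa using h1.exp.const_sub 1
  have h1 : Tendsto (fun h : ℝ => h⁻¹ * (1 - Real.exp (-lam * h))) (𝓝[>] 0) (𝓝 lam) := by
    have h2 := (hasDerivAt_iff_tendsto_slope.1 hd).mono_left
      (nhdsWithin_mono (0 : ℝ) (fun h (hh : 0 < h) => hh.ne'))
    refine h2.congr fun h => ?_
    simp [slope]
  have h2 : Tendsto (fun w : ℝ × ℝ => w.1⁻¹ * (1 - Real.exp (-lam * w.1)) * w.2)
      (𝓝[>] 0 ×ˢ 𝓝 r₀) (𝓝 (lam * r₀)) :=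
    (h1.comp tendsto_fst).mul tendsto_snd
  obtain ⟨A, hA, S, hS, h⟩ := eventually_prod_iff.1 (Metric.tendsto_nhds.1 h2 ε hε)
  refine ⟨S, hS, ?_⟩
  filter_upwards [hA, self_mem_nhdsWithin] with t ht ht0 r hr
  have ht0 : 0 < t := ht0
  have h3 := (h ht hr).le
  rw [Real.dist_eq] at h3
  calc |(1 - Real.exp (-lam * t)) * r - lam * t * r₀|
      = |t⁻¹ * (1 - Real.exp (-lam * t)) * r - lam * r₀| * t := by
        rw [show (1 - Real.exp (-lam * t)) * r - lam * t * r₀ =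
          (t⁻¹ * (1 - Real.exp (-lam * t)) * r - lam * r₀) * t by field_simp, abs_mul,
          abs_of_pos ht0]
    _ ≤ ε * t := by gcongr

/-- The derivative of a function of space and time in terms of its spatial gradient and its time
derivative. -/
theorem fderiv_prod_apply {E : Type*} [NormedAddCommGroup E] [InnerProductSpace ℝ E]
    [CompleteSpace E] {φ : E × ℝ → ℝ} {x : E} {t : ℝ} (hφ : DifferentiableAt ℝ φ (x, t))
    (v : E) (s : ℝ) :
    fderiv ℝ φ (x, t) (v, s) =
      inner ℝ v (gradient (fun z => φ (z, t)) x) + s * deriv (fun s => φ (x, s)) t := by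
  have h1 : HasFDerivAt (fun z => φ (z, t))
      ((fderiv ℝ φ (x, t)).comp (ContinuousLinearMap.inl ℝ E ℝ)) x :=
    hφ.hasFDerivAt.comp x (hasFDerivAt_prodMk_left x t)
  have h2 : HasFDerivAt (fun s => φ (x, s))
      ((fderiv ℝ φ (x, t)).comp (ContinuousLinearMap.inr ℝ E ℝ)) t :=
    hφ.hasFDerivAt.comp t (hasFDerivAt_prodMk_right x t)
  have h3 := h1.differentiableAt.hasGradientAt.fderiv_apply (y := v)
  rw [h1.fderiv] at h3
  rw [real_inner_comm, ← h3, h2.hasDerivAt.deriv]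
  have h4 : (v, s) = (v, (0 : ℝ)) + s • ((0 : E), (1 : ℝ)) := by simp
  rw [h4, map_add, map_smul]
  simp

namespace Problem

variable {d m N : ℕ} {P : Problem d m N}

/-- Trajectories have bounded speed, so they remain for a short time in a given neighbourhood of
the initial point, uniformly in the control. -/
theorem Standing.eventually_forall_trajectory (hP : P.Standing) (p : Fin N → Bool)
    {x : EuclideanSpace ℝ (Fin d)} {t : ℝ} (ht : t < P.T)
    {Q : EuclideanSpace ℝ (Fin d) × ℝ → Prop} (hQ : ∀ᶠ z in 𝓝 (x, t), Q z) :
    ∀ᶠ h in 𝓝[>] (0 : ℝ), t + h < P.T ∧ ∀ α y, Measurable α → P.IsTrajectory p x t α y →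
      ∀ s ∈ Icc t (t + h), Q (y s, s) := by
  obtain ⟨M, hM⟩ := hP.f_bounded
  obtain ⟨δ, hδ, hQ⟩ := Metric.eventually_nhds_iff.1 hQ
  have hpos : 0 < min (P.T - t) (δ / (|M| + 1)) := lt_min (sub_pos.2 ht) (by positivity)
  filter_upwards [Ioo_mem_nhdsGT hpos] with h hh
  obtain ⟨h1, h2⟩ := lt_min_iff.1 hh.2
  refine ⟨by linarith, fun α y hα hy s hs => hQ ?_⟩
  rw [lt_div_iff₀ (by positivity)] at h2
  have h3 := hy.norm_sub_le hP hα hM ⟨hs.1, by linarith [hs.2]⟩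
  have h4 : 0 ≤ s - t := sub_nonneg.2 hs.1
  have h5 : s - t ≤ h := by linarith [hs.2]
  rw [Prod.dist_eq, max_lt_iff, dist_eq_norm, Real.dist_eq, abs_of_nonneg h4]
  constructor
  · have h6 : M * (s - t) ≤ |M| * h :=
      mul_le_mul (le_abs_self M) h5 h4 (abs_nonneg M)
    linarith [hh.1]
  · nlinarith [abs_nonneg M, hh.1]

/-- The discounted running cost and the velocity in a fixed direction are continuous in space and
time, uniformly in the control, since the control set is compact. -/
theorem Standing.eventually_forall_control (hP : P.Standing) (p : Fin N → Bool)
    (x ξ : EuclideanSpace ℝ (Fin d)) {t : ℝ} (ht : t ∈ Icc 0 P.T) {ε : ℝ} (hε : 0 < ε) :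
    ∀ᶠ z in 𝓝 (x, t), z.2 ∈ Icc 0 P.T → ∀ a,
      |Real.exp (-P.lam * (z.2 - t)) * P.l z.1 a p z.2 + inner ℝ (P.f z.1 a p) ξ
        - (P.l x a p t + inner ℝ (P.f x a p) ξ)| < ε := by
  have : CompactSpace P.A := isCompact_iff_compactSpace.1 hP.A_compact
  have hl : Continuous fun z : (EuclideanSpace ℝ (Fin d) × ℝ) × P.A =>
      P.l z.1.1 z.2 p (projIcc 0 P.T hP.T_pos.le z.1.2) :=
    hP.l_continuous.comp_continuous
      (f := fun z : (EuclideanSpace ℝ (Fin d) × ℝ) × P.A =>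
        (z.1.1, z.2, p, (projIcc 0 P.T hP.T_pos.le z.1.2 : ℝ))) (by fun_prop)
      fun z => (projIcc 0 P.T hP.T_pos.le z.1.2).2
  have hf : Continuous fun z : (EuclideanSpace ℝ (Fin d) × ℝ) × P.A => P.f z.1.1 z.2 p :=
    hP.f_continuous.comp (by fun_prop : Continuous
      fun z : (EuclideanSpace ℝ (Fin d) × ℝ) × P.A => (z.1.1, z.2, p))
  have hl' : Continuous fun z : (EuclideanSpace ℝ (Fin d) × ℝ) × P.A =>
      P.l x z.2 p (projIcc 0 P.T hP.T_pos.le t) :=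
    hl.comp (by fun_prop : Continuous
      fun z : (EuclideanSpace ℝ (Fin d) × ℝ) × P.A => ((x, t), z.2))
  have hf' : Continuous fun z : (EuclideanSpace ℝ (Fin d) × ℝ) × P.A => P.f x z.2 p :=
    hf.comp (by fun_prop : Continuous
      fun z : (EuclideanSpace ℝ (Fin d) × ℝ) × P.A => ((x, t), z.2))
  have hG : Continuous fun z : (EuclideanSpace ℝ (Fin d) × ℝ) × P.A =>
      |Real.exp (-P.lam * (z.1.2 - t)) * P.l z.1.1 z.2 p (projIcc 0 P.T hP.T_pos.le z.1.2)
        + inner ℝ (P.f z.1.1 z.2 p) ξ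
        - (P.l x z.2 p (projIcc 0 P.T hP.T_pos.le t) + inner ℝ (P.f x z.2 p) ξ)| := by
    fun_prop
  have h := isCompact_univ.eventually_forall_of_forall_eventually (x₀ := (x, t)) (K := univ)
    (P := fun z a => |Real.exp (-P.lam * (z.2 - t)) *
        P.l z.1 a p (projIcc 0 P.T hP.T_pos.le z.2) + inner ℝ (P.f z.1 a p) ξ
        - (P.l x a p (projIcc 0 P.T hP.T_pos.le t) + inner ℝ (P.f x a p) ξ)| < ε)
    fun a _ => hG.continuousAt.eventually_lt_const (by simpa using hε)
  filter_upwards [h] with z hz hzT a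
  simpa only [projIcc_of_mem hP.T_pos.le hzT, projIcc_of_mem hP.T_pos.le ht]
    using hz a (mem_univ a)

/-- First-order expansion, uniform in the control, of the running cost plus the increment of a
test function along a trajectory. -/
theorem Standing.eventually_expansion (hP : P.Standing) (p : Fin N → Bool)
    {x : EuclideanSpace ℝ (Fin d)} {t : ℝ} (ht : t ∈ Ico 0 P.T)
    {φ : EuclideanSpace ℝ (Fin d) × ℝ → ℝ} (hφ : DifferentiableAt ℝ φ (x, t))
    {ε : ℝ} (hε : 0 < ε) :
    ∀ᶠ h in 𝓝[>] (0 : ℝ), ∀ α y, Measurable α → P.IsTrajectory p x t α y → ∀ c : ℝ,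
      ((∀ s, P.l x (α s) p t + inner ℝ (P.f x (α s) p) (gradient (fun z => φ (z, t)) x) ≤ c) →
        P.runningCost p t (t + h) α y + φ (y (t + h), t + h) - φ (x, t) ≤
          (c + deriv (fun s => φ (x, s)) t + ε) * h) ∧
      ((∀ s, c ≤ P.l x (α s) p t + inner ℝ (P.f x (α s) p) (gradient (fun z => φ (z, t)) x)) →
        (c + deriv (fun s => φ (x, s)) t - ε) * h ≤
          P.runningCost p t (t + h) α y + φ (y (t + h), t + h) - φ (x, t)) := by
  obtain ⟨M, hM⟩ := hP.f_bounded
  set ξ := gradient (fun z => φ (z, t)) x with hξ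
  set q := deriv (fun s => φ (x, s)) t with hq
  have h1 := hP.eventually_forall_control p x ξ ⟨ht.1, ht.2.le⟩ (ε := ε / 2) (by positivity)
  have h2 := hφ.hasFDerivAt.isLittleO.bound (c := ε / 2 / (|M| + 1)) (by positivity)
  filter_upwards [hP.eventually_forall_trajectory p ht.2 (h1.and h2), self_mem_nhdsWithin]
    with h hh hpos α y hα hy
  have hpos : 0 < h := hpos
  obtain ⟨hT, hh⟩ := hh
  have hh := hh α y hα hy
  have htm : t ∈ Icc t P.T := ⟨le_rfl, ht.2.le⟩
  have hthm : t + h ∈ Icc t P.T := ⟨by linarith, hT.le⟩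
  have hth : t ≤ t + h := by linarith
  have hyc := hy.continuousOn ht.2.le
  -- the remainder of the test function
  have hrem : |φ (y (t + h), t + h) - φ (x, t) - (inner ℝ (y (t + h) - x) ξ + h * q)|
      ≤ ε / 2 * h := by
    have h3 := (hh (t + h) ⟨hth, le_rfl⟩).2
    rw [Prod.mk_sub_mk, fderiv_prod_apply hφ, add_sub_cancel_left, Real.norm_eq_abs] at h3
    refine h3.trans ?_
    have h4 : ‖(y (t + h) - x, h)‖ ≤ (|M| + 1) * h := by
      rw [Prod.norm_mk, max_le_iff, Real.norm_of_nonneg hpos.le]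
      have h5 := hy.norm_sub_le hP hα hM hthm
      rw [add_sub_cancel_left] at h5
      constructor
      · nlinarith [le_abs_self M]
      · nlinarith [abs_nonneg M]
    calc ε / 2 / (|M| + 1) * ‖(y (t + h) - x, h)‖
        ≤ ε / 2 / (|M| + 1) * ((|M| + 1) * h) := by gcongr
      _ = ε / 2 * h := by field_simp
  have hfi := hP.intervalIntegrable_f p hα hyc htm hthm
  have hinner : inner ℝ (y (t + h) - x) ξ =
      ∫ s in t..t + h, inner ℝ (P.f (y s) (α s) p) ξ := by
    rw [← hy.1, hy.sub_eq_integral hP hα htm hthm, real_inner_comm]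
    have := (innerSL ℝ ξ).intervalIntegral_comp_comm hfi
    simp only [innerSL_apply_apply] at this
    rw [← this]
    simp only [real_inner_comm]
  have hli := hP.intervalIntegrable_runningCost p hα ht.1 hyc htm hthm t
  have hii : IntervalIntegrable (fun s => inner ℝ (P.f (y s) (α s) p) ξ) volume t (t + h) := by
    have : IntervalIntegrable (fun s => innerSL ℝ ξ (P.f (y s) (α s) p)) volume t (t + h) :=
      ⟨(innerSL ℝ ξ).integrable_comp hfi.1, (innerSL ℝ ξ).integrable_comp hfi.2⟩
    simpa only [innerSL_apply_apply, real_inner_comm] using this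
  have hsum : P.runningCost p t (t + h) α y + inner ℝ (y (t + h) - x) ξ =
      ∫ s in t..t + h, (Real.exp (-P.lam * (s - t)) * P.l (y s) (α s) p s
        + inner ℝ (P.f (y s) (α s) p) ξ) := by
    rw [intervalIntegral.integral_add hli hii, hinner, runningCost]
  have hclose : ∀ s ∈ Icc t (t + h),
      |Real.exp (-P.lam * (s - t)) * P.l (y s) (α s) p s + inner ℝ (P.f (y s) (α s) p) ξ
        - (P.l x (α s) p t + inner ℝ (P.f x (α s) p) ξ)| < ε / 2 := fun s hs =>
    (hh s hs).1 ⟨ht.1.trans hs.1, hs.2.trans hT.le⟩ (α s)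
  obtain ⟨hr1, hr2⟩ := abs_le.1 hrem
  intro c
  constructor
  · intro hc
    have h5 := intervalIntegral.integral_mono_on hth (hli.add hii)
      (intervalIntegrable_const (c := c + ε / 2)) fun s hs => by
        linarith [(abs_lt.1 (hclose s hs)).2, hc s]
    rw [← hsum, intervalIntegral.integral_const, add_sub_cancel_left, smul_eq_mul] at h5
    linarith
  · intro hc
    have h5 := intervalIntegral.integral_mono_on hth
      (intervalIntegrable_const (c := c - ε / 2)) (hli.add hii) fun s hs => by
        linarith [(abs_lt.1 (hclose s hs)).1, hc s]
    rw [← hsum, intervalIntegral.integral_const, add_sub_cancel_left, smul_eq_mul] at h5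
    linarith

theorem Standing.bddAbove_hamiltonian (hP : P.Standing) (p : Fin N → Bool)
    (x : EuclideanSpace ℝ (Fin d)) {t : ℝ} (ht : t ∈ Icc 0 P.T)
    (ξ : EuclideanSpace ℝ (Fin d)) :
    BddAbove (range fun a : P.A => -inner ℝ (P.f x a p) ξ - P.l x a p t) := by
  obtain ⟨M, hM⟩ := hP.f_bounded
  refine ⟨M * ‖ξ‖, ?_⟩
  rintro _ ⟨a, rfl⟩
  have h1 := (abs_le.1 (abs_real_inner_le_norm (P.f x a p) ξ)).1
  have h2 := mul_le_mul_of_nonneg_right (hM x a p) (norm_nonneg ξ)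
  have h3 := hP.l_nonneg x a p t ht
  dsimp only
  linarith

/-- For a continuous `V`, the discount loss on `V` along a trajectory of duration `h` is
`λ h V(x, t)` to first order, uniformly in the control. -/
theorem Standing.eventually_discount (hP : P.Standing) {p : Fin N → Bool}
    {x : EuclideanSpace ℝ (Fin d)} {t : ℝ} (ht : t ∈ Ico 0 P.T)
    {V : EuclideanSpace ℝ (Fin d) → ℝ → ℝ} (hV : P.IsBUC V) {ε : ℝ} (hε : 0 < ε) :
    ∀ᶠ h in 𝓝[>] (0 : ℝ), ∀ α y, Measurable α → P.IsTrajectory p x t α y →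
      |(1 - Real.exp (-P.lam * h)) * V (y (t + h)) (t + h) - P.lam * h * V x t| ≤ ε * h := by
  obtain ⟨S, hS, hev⟩ := eventually_one_sub_exp_mul P.lam (V x t) hε
  have hc := hV.2.continuousOn (x, t) ⟨mem_univ _, ht.1, ht.2.le⟩
  have h1 := eventually_nhdsWithin_iff.1 (hc.eventually hS)
  filter_upwards [hev, hP.eventually_forall_trajectory p ht.2 h1, self_mem_nhdsWithin]
    with h h2 h3 hpos α y hα hy
  have hpos : 0 < h := hpos
  exact h2 _ (h3.2 α y hα hy (t + h) ⟨by linarith, le_rfl⟩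
    ⟨mem_univ _, by linarith [ht.1], h3.1.le⟩)

theorem Standing.isViscositySubsolution_value (hP : P.Standing) {p : Fin N → Bool}
    (hp : p ≠ pbar N) (hV : P.IsBUC (P.value p)) :
    P.IsViscositySubsolution p (P.value p) := by
  intro φ hφ x t ht hmax
  have : Nonempty P.A := hP.A_nonempty.to_subtype
  refine max_le (sub_nonpos.2 (hP.value_le_psi hp x ⟨ht.1, ht.2.le⟩)) ?_
  suffices h : P.hamiltonian p x t (gradient (fun z => φ (z, t)) x) ≤
      deriv (fun s => φ (x, s)) t - P.lam * P.value p x t by linarith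
  refine ciSup_le fun a => le_of_forall_pos_le_add fun ε hε => ?_
  have hmax' := eventually_nhdsWithin_iff.1 hmax
  obtain ⟨h, ⟨⟨h1, ⟨hT, h2⟩⟩, h3⟩, hpos⟩ :=
    (((hP.eventually_expansion p ht (hφ.differentiable one_ne_zero _)
      (half_pos hε)).and (hP.eventually_forall_trajectory p ht.2 hmax')).and
      (hP.eventually_discount (p := p) ht hV (half_pos hε))).and self_mem_nhdsWithin |>.exists
  have hpos : 0 < h := hpos
  obtain ⟨y, hy⟩ := hP.exists_isTrajectory p x ht.2.le (measurable_const (a := a))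
  have h1 := (h1 _ y measurable_const hy _).1 (fun _ => le_rfl)
  have h2 := h2 _ y measurable_const hy (t + h) ⟨by linarith, le_rfl⟩
    ⟨mem_univ _, by linarith [ht.1], hT⟩
  have h3 := (abs_le.1 (h3 _ y measurable_const hy)).1
  have h4 := hP.value_le_runningCost_add hp ht.1 measurable_const hy (t' := t + h)
    ⟨by linarith, hT.le⟩
  rw [add_sub_cancel_left] at h4
  dsimp only at h2
  have h5 : P.lam * P.value p x t * h ≤
      (P.l x a p t + inner ℝ (P.f x a p) (gradient (fun z => φ (z, t)) x)
        + deriv (fun s => φ (x, s)) t + ε) * h := by nlinarith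
  linarith [le_of_mul_le_mul_right h5 hpos]

/-- Where the value is below the stopping cost, near-optimal strategies do not stop for a short
time, so dynamic programming along them gives the differential inequality. -/
theorem Standing.isViscositySupersolution_value (hP : P.Standing) {p : Fin N → Bool}
    (hp : p ≠ pbar N) (hψ : P.IsBUC (P.psi p)) (hV : P.IsBUC (P.value p)) :
    P.IsViscositySupersolution p (P.value p) := by
  intro φ hφ x t ht hmin
  rcases le_or_gt (P.psi p x t) (P.value p x t) with hle | hlt
  · exact le_max_of_le_left (sub_nonneg.2 hle)
  refine le_max_of_le_right (le_of_forall_pos_le_add fun ε hε => ?_)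
  have htI : t ∈ Icc 0 P.T := ⟨ht.1, ht.2.le⟩
  have hmin' := eventually_nhdsWithin_iff.1 hmin
  -- the stopping cost stays above the value along short trajectories, even when discounted
  set γ := P.psi p x t - P.value p x t with hγ
  have hγ0 : 0 < γ := sub_pos.2 hlt
  have hobs : ∀ᶠ z in 𝓝 (x, t), z ∈ univ ×ˢ Icc 0 P.T →
      P.value p x t + γ / 2 < Real.exp (-P.lam * (z.2 - t)) * P.psi p z.1 z.2 := by
    refine eventually_nhdsWithin_iff.1 ?_
    have hc : ContinuousWithinAt (fun z : EuclideanSpace ℝ (Fin d) × ℝ =>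
        Real.exp (-P.lam * (z.2 - t)) * P.psi p z.1 z.2) (univ ×ˢ Icc 0 P.T) (x, t) :=
      (Continuous.continuousWithinAt (by fun_prop)).mul
        (hψ.2.continuousOn (x, t) ⟨mem_univ _, htI⟩)
    refine hc.eventually_const_lt ?_
    simp only [sub_self, mul_zero, Real.exp_zero, one_mul]
    linarith
  have hsmall : ∀ᶠ h in 𝓝[>] (0 : ℝ), ε / 3 * h < γ / 2 := by
    have : Tendsto (fun h : ℝ => ε / 3 * h) (𝓝[>] 0) (𝓝 (ε / 3 * 0)) :=
      (Continuous.tendsto (by fun_prop) 0).mono_left nhdsWithin_le_nhds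
    exact this.eventually_lt_const (by simpa using hγ0)
  obtain ⟨h, ⟨⟨⟨h1, ⟨hT, h2⟩⟩, h3⟩, h4⟩, hpos⟩ :=
    ((((hP.eventually_expansion p ht (hφ.differentiable one_ne_zero _)
      (ε := ε / 3) (by positivity)).and
      (hP.eventually_forall_trajectory p ht.2 (hmin'.and hobs))).and
      (hP.eventually_discount (p := p) ht hV (ε := ε / 3) (by positivity))).and hsmall).and
      self_mem_nhdsWithin |>.exists
  have hpos : 0 < h := hpos
  obtain ⟨α, y, τ, hα, hy, hτ, hJ⟩ :=
    hP.exists_stoppingCost_lt hp x ht.2.le (ε := ε / 3 * h) (by positivity)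
  have hτh : t + h ≤ τ := by
    by_contra! hcon
    have h5 := (h2 α y hα hy τ ⟨hτ.1, hcon.le⟩).2 ⟨mem_univ _, ht.1.trans hτ.1, hτ.2⟩
    have h6 := hP.runningCost_nonneg p α y ht.1 hτ
    dsimp only at h5
    unfold stoppingCost at hJ
    linarith
  have h5 := hP.runningCost_add_le_stoppingCost hp ht.1 hα hy ⟨by linarith, hτh⟩ hτ.2
  have h1 := (h1 α y hα hy (-P.hamiltonian p x t (gradient (fun z => φ (z, t)) x))).2
    (fun s => by
      have := le_ciSup (hP.bddAbove_hamiltonian p x htI (gradient (fun z => φ (z, t)) x)) (α s)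
      unfold hamiltonian
      linarith)
  have h2 := (h2 α y hα hy (t + h) ⟨by linarith, le_rfl⟩).1
    ⟨mem_univ _, by linarith [ht.1], hT⟩
  have h3 := (abs_le.1 (h3 α y hα hy)).2
  rw [add_sub_cancel_left] at h5
  dsimp only at h2
  have h6 : 0 ≤ (-deriv (fun s => φ (x, s)) t + P.lam * P.value p x t
      + P.hamiltonian p x t (gradient (fun z => φ (z, t)) x) + ε) * h := by nlinarith
  exact nonneg_of_mul_nonneg_left h6 hpos

end Problem

/-! ### Comparison by doubling the variables -/

/-- The test function `c t + (k / 2) (‖x - b‖² + (t - r)²) + β ‖x‖²` on space-time.  When the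
variables are doubled, the other copy is frozen at `(b, r)`; the signs of `k` and `β` are negative for the
supersolution. -/
def quadraticTest {E : Type*} [NormedAddCommGroup E] (c k β : ℝ) (b : E) (r : ℝ)
    (z : E × ℝ) : ℝ :=
  c * z.2 + k / 2 * (‖z.1 - b‖ ^ 2 + (z.2 - r) ^ 2) + β * ‖z.1‖ ^ 2

theorem contDiff_quadraticTest {E : Type*} [NormedAddCommGroup E] [InnerProductSpace ℝ E]
    (c k β : ℝ) (b : E) (r : ℝ) :
    ContDiff ℝ 1 (quadraticTest c k β b r) := by
  unfold quadraticTest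
  have h1 : ContDiff ℝ 1 fun z : E × ℝ => ‖z.1 - b‖ ^ 2 :=
    (contDiff_fst.sub contDiff_const).norm_sq ℝ
  have h2 : ContDiff ℝ 1 fun z : E × ℝ => ‖z.1‖ ^ 2 := contDiff_fst.norm_sq ℝ
  fun_prop

theorem deriv_quadraticTest {E : Type*} [NormedAddCommGroup E] (c k β : ℝ) (b : E)
    (r : ℝ) (x : E) (t : ℝ) :
    deriv (fun s => quadraticTest c k β b r (x, s)) t = c + k * (t - r) := by
  have h1 : HasDerivAt (fun s : ℝ => (s - r) ^ 2) (2 * (t - r)) t := by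
    simpa using ((hasDerivAt_id t).sub_const r).fun_pow 2
  have h2 : HasDerivAt (fun s => quadraticTest c k β b r (x, s))
      (c * 1 + k / 2 * (2 * (t - r))) t :=
    (((hasDerivAt_id' t).const_mul c).fun_add
      ((h1.const_add (‖x - b‖ ^ 2)).const_mul (k / 2))).add_const (β * ‖x‖ ^ 2)
  rw [h2.deriv]
  ring

theorem gradient_quadraticTest {E : Type*} [NormedAddCommGroup E] [InnerProductSpace ℝ E]
    [CompleteSpace E] (c k β : ℝ) (b : E) (r : ℝ) (x : E) (t : ℝ) :
    gradient (fun z => quadraticTest c k β b r (z, t)) x = k • (x - b) + (2 * β) • x := by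
  refine HasGradientAt.gradient (hasGradientAt_iff_hasFDerivAt.2 ?_)
  have h1 : HasFDerivAt (fun z : E => ‖z - b‖ ^ 2) (2 • innerSL ℝ (x - b)) x := by
    simpa using ((hasFDerivAt_id x).sub_const b).norm_sq
  have h2 : HasFDerivAt (fun z : E => ‖z‖ ^ 2) (2 • innerSL ℝ x) x := by
    simpa using (hasFDerivAt_id x).norm_sq
  have h3 := (((h1.add_const ((t - r) ^ 2)).const_mul (k / 2)).const_add (c * t)).add
    (h2.const_mul β)
  refine h3.congr_fderiv ?_
  ext v
  simp
  ring

/-- A bounded continuous function of a doubled variable, penalized by the squared distance of the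
two copies and by their squared norms, attains its maximum over `ℝ^d × [0, T]`. -/
theorem exists_doubling_max {E : Type*} [NormedAddCommGroup E] [ProperSpace E] {T K β k : ℝ}
    (hβ : 0 < β) (hk : 0 ≤ k) {g : (E × ℝ) × E × ℝ → ℝ}
    (hg : ContinuousOn g ((univ ×ˢ Icc 0 T) ×ˢ (univ ×ˢ Icc 0 T)))
    (hK : ∀ z ∈ (univ ×ˢ Icc 0 T : Set (E × ℝ)) ×ˢ (univ ×ˢ Icc 0 T : Set (E × ℝ)), g z ≤ K)
    {z₀ : (E × ℝ) × E × ℝ} (hz₀ : z₀ ∈ (univ ×ˢ Icc 0 T : Set (E × ℝ)) ×ˢ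
      (univ ×ˢ Icc 0 T : Set (E × ℝ)))
    (h0 : 0 ≤ g z₀ - k / 2 * (‖z₀.1.1 - z₀.2.1‖ ^ 2 + (z₀.1.2 - z₀.2.2) ^ 2)
      - β * (‖z₀.1.1‖ ^ 2 + ‖z₀.2.1‖ ^ 2)) :
    ∃ z ∈ (univ ×ˢ Icc 0 T : Set (E × ℝ)) ×ˢ (univ ×ˢ Icc 0 T : Set (E × ℝ)),
      IsMaxOn (fun z : (E × ℝ) × E × ℝ =>
        g z - k / 2 * (‖z.1.1 - z.2.1‖ ^ 2 + (z.1.2 - z.2.2) ^ 2)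
          - β * (‖z.1.1‖ ^ 2 + ‖z.2.1‖ ^ 2))
        ((univ ×ˢ Icc 0 T) ×ˢ (univ ×ˢ Icc 0 T)) z := by
  have hclosed : IsClosed (univ ×ˢ Icc 0 T : Set (E × ℝ)) := isClosed_univ.prod isClosed_Icc
  refine ContinuousOn.exists_isMaxOn' ?_ (hclosed.prod hclosed) hz₀ ?_
  · refine (hg.sub ?_).sub ?_ <;> exact Continuous.continuousOn (by fun_prop)
  set R := |K| / β + 1 with hR
  have hR1 : 1 ≤ R := by
    have : 0 ≤ |K| / β := by positivity
    linarith
  have hRK : K < β * R := by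
    rw [hR, mul_add, mul_div_cancel₀ _ hβ.ne']
    linarith [le_abs_self K]
  have hcpt : IsCompact (Metric.closedBall (0 : E) R ×ˢ Icc 0 T) :=
    (isCompact_closedBall 0 R).prod isCompact_Icc
  rw [eventually_inf_principal]
  filter_upwards [(hcpt.prod hcpt).compl_mem_cocompact] with z hz hzS
  -- outside a large ball the penalization exceeds the bound on `g`
  have hbig : R < ‖z.1.1‖ ∨ R < ‖z.2.1‖ := by
    by_contra! hcon
    refine hz ⟨⟨?_, hzS.1.2⟩, ⟨?_, hzS.2.2⟩⟩
    · simpa using hcon.1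
    · simpa using hcon.2
  have hsq : R ≤ ‖z.1.1‖ ^ 2 + ‖z.2.1‖ ^ 2 := by
    rcases hbig with h | h
    · nlinarith [sq_nonneg ‖z.2.1‖]
    · nlinarith [sq_nonneg ‖z.1.1‖]
  have h1 : β * R ≤ β * (‖z.1.1‖ ^ 2 + ‖z.2.1‖ ^ 2) := by gcongr
  have h2 : 0 ≤ k / 2 * (‖z.1.1 - z.2.1‖ ^ 2 + (z.1.2 - z.2.2) ^ 2) := by positivity
  refine le_trans ?_ h0
  linarith [hK z hzS]

/-- The doubling of variables for two bounded continuous functions `u` and `v` with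
`u(x, t) > v(x, t)` somewhere: a maximum point of the doubled function, with the weight `γ²` on the
squared norms and the weight `k / 2` on the squared distance of the two copies.  The bound on the
distance comes from comparison with the two diagonal points, where the other penalizations
cancel. -/
theorem exists_doubling_point {E : Type*} [NormedAddCommGroup E] [ProperSpace E]
    {T K₁ K₂ γ k η θ : ℝ} (hγ : 0 < γ) (hk : 0 < k) (hη : 0 ≤ η) (hθ : 0 < θ) {u v : E → ℝ → ℝ}
    (hu : ContinuousOn (fun z : E × ℝ => u z.1 z.2) (univ ×ˢ Icc 0 T))
    (hv : ContinuousOn (fun z : E × ℝ => v z.1 z.2) (univ ×ˢ Icc 0 T))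
    (hK₁ : ∀ x, ∀ t ∈ Icc 0 T, |u x t| ≤ K₁) (hK₂ : ∀ x, ∀ t ∈ Icc 0 T, |v x t| ≤ K₂)
    {x : E} {t : ℝ} (ht : t ∈ Icc 0 T)
    (hstart : θ ≤ u x t - v x t - η * (T - t) - 2 * γ ^ 2 * ‖x‖ ^ 2) :
    ∃ x' y' : E, ∃ t' ∈ Icc 0 T, ∃ s' ∈ Icc 0 T,
      (∀ x₁, ∀ t₁ ∈ Icc 0 T, ∀ y₁, ∀ s₁ ∈ Icc 0 T,
        u x₁ t₁ - v y₁ s₁ - η / 2 * (T - t₁) - η / 2 * (T - s₁)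
          - k / 2 * (‖x₁ - y₁‖ ^ 2 + (t₁ - s₁) ^ 2) - γ ^ 2 * (‖x₁‖ ^ 2 + ‖y₁‖ ^ 2) ≤
        u x' t' - v y' s' - η / 2 * (T - t') - η / 2 * (T - s')
          - k / 2 * (‖x' - y'‖ ^ 2 + (t' - s') ^ 2) - γ ^ 2 * (‖x'‖ ^ 2 + ‖y'‖ ^ 2)) ∧
      θ ≤ u x' t' - v y' s' ∧ γ * ‖x'‖ ≤ K₁ + K₂ + 1 ∧ γ * ‖y'‖ ≤ K₁ + K₂ + 1 ∧
      k * (‖x' - y'‖ ^ 2 + (t' - s') ^ 2) ≤ (u x' t' - u y' s') + (v x' t' - v y' s') := by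
  have hβ0 : 0 < γ ^ 2 := by positivity
  set g : (E × ℝ) × E × ℝ → ℝ := fun z =>
    u z.1.1 z.1.2 - v z.2.1 z.2.2 - η / 2 * (T - z.1.2) - η / 2 * (T - z.2.2) with hg
  have hgc : ContinuousOn g ((univ ×ˢ Icc 0 T) ×ˢ (univ ×ˢ Icc 0 T)) := by
    have hu' := hu.comp (s := (univ ×ˢ Icc 0 T) ×ˢ (univ ×ˢ Icc 0 T : Set (E × ℝ)))
      continuousOn_fst (fun z hz => hz.1)
    have hv' := hv.comp (s := (univ ×ˢ Icc 0 T : Set (E × ℝ)) ×ˢ (univ ×ˢ Icc 0 T))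
      continuousOn_snd (fun z hz => hz.2)
    refine ((hu'.sub hv').sub ?_).sub ?_ <;> exact Continuous.continuousOn (by fun_prop)
  have hgK : ∀ z ∈ (univ ×ˢ Icc 0 T : Set (E × ℝ)) ×ˢ (univ ×ˢ Icc 0 T : Set (E × ℝ)),
      g z ≤ K₁ + K₂ := by
    intro z hz
    have h6 := (abs_le.1 (hK₁ z.1.1 z.1.2 hz.1.2)).2
    have h7 := (abs_le.1 (hK₂ z.2.1 z.2.2 hz.2.2)).1
    have h8 := mul_nonneg (div_nonneg hη zero_le_two) (sub_nonneg.2 hz.1.2.2)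
    have h9 := mul_nonneg (div_nonneg hη zero_le_two) (sub_nonneg.2 hz.2.2.2)
    simp only [hg]
    linarith only [h6, h7, h8, h9]
  have hstart' : θ ≤ g ((x, t), (x, t)) - k / 2 * (‖x - x‖ ^ 2 + (t - t) ^ 2)
      - γ ^ 2 * (‖x‖ ^ 2 + ‖x‖ ^ 2) := by
    simp only [hg, sub_self, norm_zero]
    linarith only [hstart]
  obtain ⟨⟨⟨x', t'⟩, ⟨y', s'⟩⟩, ⟨⟨-, ht'⟩, ⟨-, hs'⟩⟩, hmax⟩ := exists_doubling_max hβ0 hk.le hgc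
    hgK (z₀ := ((x, t), (x, t))) ⟨⟨mem_univ _, ht⟩, ⟨mem_univ _, ht⟩⟩ (hθ.le.trans hstart')
  have hmax : ∀ x₁, ∀ t₁ ∈ Icc 0 T, ∀ y₁, ∀ s₁ ∈ Icc 0 T,
      g ((x₁, t₁), (y₁, s₁)) - k / 2 * (‖x₁ - y₁‖ ^ 2 + (t₁ - s₁) ^ 2)
        - γ ^ 2 * (‖x₁‖ ^ 2 + ‖y₁‖ ^ 2) ≤
      g ((x', t'), (y', s')) - k / 2 * (‖x' - y'‖ ^ 2 + (t' - s') ^ 2)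
        - γ ^ 2 * (‖x'‖ ^ 2 + ‖y'‖ ^ 2) := fun x₁ t₁ ht₁ y₁ s₁ hs₁ =>
    hmax (show ((x₁, t₁), (y₁, s₁)) ∈ _ from ⟨⟨mem_univ _, ht₁⟩, ⟨mem_univ _, hs₁⟩⟩)
  simp only [hg] at hmax hstart' ht' hs'
  have hval := hstart'.trans (hmax x t ht x t ht)
  have hηt : 0 ≤ η / 2 * (T - t') := mul_nonneg (div_nonneg hη zero_le_two) (sub_nonneg.2 ht'.2)
  have hηs : 0 ≤ η / 2 * (T - s') := mul_nonneg (div_nonneg hη zero_le_two) (sub_nonneg.2 hs'.2)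
  have hpen : 0 ≤ k / 2 * (‖x' - y'‖ ^ 2 + (t' - s') ^ 2) := by positivity
  have hβx : 0 ≤ γ ^ 2 * ‖x'‖ ^ 2 := by positivity
  have hβy : 0 ≤ γ ^ 2 * ‖y'‖ ^ 2 := by positivity
  have hgap : θ ≤ u x' t' - v y' s' := by
    linarith only [hval, hηt, hηs, hpen, hβx, hβy]
  have hKn : 0 ≤ K₁ + K₂ + 1 := by
    linarith only [(abs_nonneg _).trans (hK₁ x t ht), (abs_nonneg _).trans (hK₂ x t ht)]
  have hsum : γ ^ 2 * ‖x'‖ ^ 2 + γ ^ 2 * ‖y'‖ ^ 2 ≤ (K₁ + K₂ + 1) ^ 2 := by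
    have h6 := (abs_le.1 (hK₁ x' t' ht')).2
    have h7 := (abs_le.1 (hK₂ y' s' hs')).1
    have h8 : γ ^ 2 * ‖x'‖ ^ 2 + γ ^ 2 * ‖y'‖ ^ 2 ≤ K₁ + K₂ := by
      linarith only [hval, hηt, hηs, hpen, h6, h7, hθ]
    nlinarith only [h8, hKn]
  have hdiag : k * (‖x' - y'‖ ^ 2 + (t' - s') ^ 2) ≤
      (u x' t' - u y' s') + (v x' t' - v y' s') := by
    have h6 := hmax x' t' ht' x' t' ht'
    have h7 := hmax y' s' hs' y' s' hs'
    simp only [sub_self, norm_zero] at h6 h7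
    linarith only [h6, h7]
  refine ⟨x', y', t', ht', s', hs', hmax, hgap, le_of_sq_le_sq ?_ hKn, le_of_sq_le_sq ?_ hKn,
    hdiag⟩
  · rw [mul_pow]
    linarith only [hsum, hβy]
  · rw [mul_pow]
    linarith only [hsum, hβx]

namespace Problem

variable {d m N : ℕ} {P : Problem d m N}

/-- On bounded sets the running cost is uniformly continuous in time, uniformly in the control. -/
theorem Standing.exists_modulus_l_time (hP : P.Standing) (p : Fin N → Bool) (R : ℝ) {ε : ℝ}
    (hε : 0 < ε) : ∃ δ > 0, ∀ x, ‖x‖ ≤ R → ∀ a, ∀ t ∈ Icc 0 P.T, ∀ s ∈ Icc 0 P.T,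
      |t - s| < δ → |P.l x a p t - P.l x a p s| < ε := by
  have : CompactSpace P.A := isCompact_iff_compactSpace.1 hP.A_compact
  have hc : ContinuousOn (fun z : EuclideanSpace ℝ (Fin d) × P.A × ℝ => P.l z.1 z.2.1 p z.2.2)
      (Metric.closedBall 0 R ×ˢ univ ×ˢ Icc 0 P.T) :=
    hP.l_continuous.comp (f := fun z : EuclideanSpace ℝ (Fin d) × P.A × ℝ =>
      (z.1, z.2.1, p, z.2.2)) (Continuous.continuousOn (by fun_prop)) fun z hz => hz.2.2
  have huc := ((isCompact_closedBall 0 R).prod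
    (isCompact_univ.prod isCompact_Icc)).uniformContinuousOn_of_continuous hc
  obtain ⟨δ, hδ, h⟩ := Metric.uniformContinuousOn_iff.1 huc ε hε
  refine ⟨δ, hδ, fun x hx a t ht s hs hts => ?_⟩
  have := h (x, a, t) ⟨by simpa using hx, mem_univ _, ht⟩ (x, a, s)
    ⟨by simpa using hx, mem_univ _, hs⟩ (by simpa [Prod.dist_eq, Real.dist_eq, hδ] using hts)
  rwa [Real.dist_eq] at this

/-- The structure condition on the Hamiltonian at a maximum point of the doubled function. -/
theorem Standing.hamiltonian_sub_le (hP : P.Standing) (p : Fin N → Bool) {M L k β c : ℝ}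
    (hM : ∀ x a p, ‖P.f x a p‖ ≤ M)
    (hLip : ∀ x y a p, ‖P.f x a p - P.f y a p‖ ≤ L * ‖x - y‖) (hk : 0 ≤ k) (hβ : 0 ≤ β)
    {x y : EuclideanSpace ℝ (Fin d)} {t s : ℝ} (ht : t ∈ Icc 0 P.T)
    (hl : ∀ a, P.l x a p t ≤ P.l y a p s + c) :
    P.hamiltonian p y s (k • (x - y) - (2 * β) • y) ≤
      P.hamiltonian p x t (k • (x - y) + (2 * β) • x)
        + (L * (k * ‖x - y‖ ^ 2) + 2 * β * M * (‖x‖ + ‖y‖) + c) := by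
  have : Nonempty P.A := hP.A_nonempty.to_subtype
  refine ciSup_le fun a => ?_
  have h1 : -inner ℝ (P.f x a p) (k • (x - y) + (2 * β) • x) - P.l x a p t ≤ _ :=
    le_ciSup (hP.bddAbove_hamiltonian p x ht (k • (x - y) + (2 * β) • x)) a
  change _ ≤ P.hamiltonian p x t (k • (x - y) + (2 * β) • x) at h1
  rw [inner_add_right, inner_smul_right, inner_smul_right] at h1
  rw [inner_sub_right, inner_smul_right, inner_smul_right]
  have h2 : inner ℝ (P.f x a p) (x - y) - inner ℝ (P.f y a p) (x - y) ≤ L * ‖x - y‖ ^ 2 := by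
    rw [← inner_sub_left]
    refine (real_inner_le_norm _ _).trans ?_
    nlinarith [hLip x y a p, norm_nonneg (x - y)]
  have h3 : ∀ z, inner ℝ (P.f z a p) z ≤ M * ‖z‖ := fun z =>
    (real_inner_le_norm _ _).trans (mul_le_mul_of_nonneg_right (hM z a p) (norm_nonneg z))
  have h4 := mul_le_mul_of_nonneg_left h2 hk
  have h5 := mul_le_mul_of_nonneg_left (add_le_add (h3 x) (h3 y))
    (by positivity : 0 ≤ 2 * β)
  have h6 := hl a
  nlinarith

/-- Comparison principle for the obstacle problem. -/
theorem Standing.le_of_subsolution_of_supersolution (hP : P.Standing) {p : Fin N → Bool}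
    (hψ : P.IsBUC (P.psi p)) {u v : EuclideanSpace ℝ (Fin d) → ℝ → ℝ} (hu : P.IsBUC u)
    (hv : P.IsBUC v) (hsub : P.IsViscositySubsolution p u)
    (hsuper : P.IsViscositySupersolution p v) (hT : ∀ x, u x P.T ≤ v x P.T)
    (x : EuclideanSpace ℝ (Fin d)) {t : ℝ} (ht : t ∈ Icc 0 P.T) : u x t ≤ v x t := by
  by_contra! hcon
  obtain ⟨M, hM⟩ := hP.f_bounded
  obtain ⟨L, hL, hLip⟩ := hP.f_lipschitz
  obtain ⟨K₁, hK₁⟩ := hu.1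
  obtain ⟨K₂, hK₂⟩ := hv.1
  have hTpos := hP.T_pos
  have hlam := hP.lam_nonneg
  set K := K₁ + K₂ with hK
  have hK0 : 0 ≤ K := add_nonneg ((abs_nonneg _).trans (hK₁ x t ht))
    ((abs_nonneg _).trans (hK₂ x t ht))
  set σ := u x t - v x t with hσ
  have hσ0 : 0 < σ := sub_pos.2 hcon
  -- `η` makes the subsolution strict
  set η := σ / (4 * P.T) with hη
  have hη0 : 0 < η := by positivity
  have hηT : η * P.T = σ / 4 := by rw [hη]; field_simp
  -- the penalization at infinity, whose gradient at the maximum points is of order `γ`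
  obtain ⟨γ, hγ0, hγ1, hγx, hγη⟩ : ∃ γ : ℝ, 0 < γ ∧ γ ≤ 1 ∧ γ * (8 * (‖x‖ ^ 2 + 1)) ≤ σ ∧
      γ * (16 * (|M| + 1) * (K + 1)) ≤ η := by
    refine ⟨min 1 (min (σ / (8 * (‖x‖ ^ 2 + 1))) (η / (16 * (|M| + 1) * (K + 1)))),
      by positivity, min_le_left _ _, ?_, ?_⟩
    · rw [← le_div_iff₀ (by positivity)]
      exact (min_le_right _ _).trans (min_le_left _ _)
    · rw [← le_div_iff₀ (by positivity)]
      exact (min_le_right _ _).trans (min_le_right _ _)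
  set β := γ ^ 2 with hβ
  have hβ0 : 0 < β := by positivity
  -- moduli of continuity; the running cost is only needed on a ball that contains the maximum point
  set ε := min (σ / 4) (η / (8 * L)) with hε
  have hε0 : 0 < ε := by positivity
  have hεσ : ε ≤ σ / 4 := min_le_left _ _
  have hεL : L * (2 * ε) ≤ η / 4 := by
    have : ε ≤ η / (8 * L) := min_le_right _ _
    rw [le_div_iff₀ (by positivity)] at this
    linarith
  obtain ⟨δ₁, hδ₁, hmu⟩ := hu.exists_modulus hε0
  obtain ⟨δ₂, hδ₂, hmv⟩ := hv.exists_modulus hε0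
  obtain ⟨δ₃, hδ₃, hmψ⟩ := hψ.exists_modulus hε0
  obtain ⟨δ₄, hδ₄, hml⟩ := hP.l_unifCont (η / 8) (by positivity)
  obtain ⟨δ₅, hδ₅, hmt⟩ := hP.exists_modulus_l_time p ((K + 1) / γ) (ε := η / 8) (by positivity)
  obtain ⟨δ, hδ0, h1, h2, h3, h4, h5⟩ : ∃ δ > 0, δ ≤ δ₁ ∧ δ ≤ δ₂ ∧ δ ≤ δ₃ ∧ δ ≤ δ₄ ∧ δ ≤ δ₅ :=
    ⟨min δ₁ (min δ₂ (min δ₃ (min δ₄ δ₅))), by positivity, by simp, by simp, by simp, by simp,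
      by simp⟩
  set k := (2 * K + 1) / δ ^ 2 with hk
  have hk0 : 0 < k := by positivity
  have hkδ : k * δ ^ 2 = 2 * K + 1 := by rw [hk]; field_simp
  have hstart : σ / 2 ≤ u x t - v x t - η * (P.T - t) - 2 * γ ^ 2 * ‖x‖ ^ 2 := by
    have h6 : γ ^ 2 * ‖x‖ ^ 2 ≤ γ * ‖x‖ ^ 2 :=
      mul_le_mul_of_nonneg_right (by nlinarith only [hγ0, hγ1]) (sq_nonneg ‖x‖)
    have h8 : 0 ≤ η * t := mul_nonneg hη0.le ht.1
    linarith only [h6, h8, hγx, hγ0, hηT, hσ]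
  obtain ⟨x', y', t', ht', s', hs', hmax, hgap, hγnx, hγny, hdiag⟩ :=
    exists_doubling_point hγ0 hk0 hη0.le (half_pos hσ0) hu.2.continuousOn hv.2.continuousOn
      hK₁ hK₂ ht hstart
  have hdist : ‖x' - y'‖ ^ 2 + (t' - s') ^ 2 < δ ^ 2 := by
    have h6 := (abs_le.1 (hK₁ x' t' ht')).2
    have h7 := (abs_le.1 (hK₁ y' s' hs')).1
    have h8 := (abs_le.1 (hK₂ x' t' ht')).2
    have h9 := (abs_le.1 (hK₂ y' s' hs')).1
    refine lt_of_mul_lt_mul_left (a := k) ?_ hk0.le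
    linarith
  have hx : ‖x' - y'‖ < δ := lt_of_pow_lt_pow_left₀ 2 hδ0.le (by linarith [sq_nonneg (t' - s')])
  have hts : |t' - s'| < δ := lt_of_pow_lt_pow_left₀ 2 hδ0.le (by
    rw [sq_abs]; linarith [sq_nonneg ‖x' - y'‖])
  have hmu' := abs_lt.1 (hmu x' y' t' ht' s' hs' (hx.trans_le h1) (hts.trans_le h1))
  have hmv' := abs_lt.1 (hmv x' y' t' ht' s' hs' (hx.trans_le h2) (hts.trans_le h2))
  have hmψ' := abs_lt.1 (hmψ x' y' t' ht' s' hs' (hx.trans_le h3) (hts.trans_le h3))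
  -- the terminal condition excludes maximum points at the final time
  have htT : t' ∈ Ico 0 P.T := ⟨ht'.1, lt_of_le_of_ne ht'.2 fun h => by
    have := hT x'
    rw [← h] at this
    linarith⟩
  have hsT : s' ∈ Ico 0 P.T := ⟨hs'.1, lt_of_le_of_ne hs'.2 fun h => by
    have := hT y'
    rw [← h] at this
    linarith⟩
  have hsub' := hsub (quadraticTest (-(η / 2)) k β y' s') (contDiff_quadraticTest _ _ _ _ _)
    x' t' htT (by
      refine IsMaxOn.localize fun z hz => ?_
      have h6 := hmax z.1 z.2 ⟨hz.2.1, hz.2.2.le⟩ y' s' hs'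
      simp only [quadraticTest, mem_ofPred_eq]
      linarith)
  have hsuper' := hsuper (quadraticTest (η / 2) (-k) (-β) x' t')
    (contDiff_quadraticTest _ _ _ _ _) y' s' hsT (by
      refine IsMinOn.localize fun z hz => ?_
      have h6 := hmax x' t' ht' z.1 z.2 ⟨hz.2.1, hz.2.2.le⟩
      simp only [quadraticTest, mem_ofPred_eq]
      rw [norm_sub_rev z.1 x', norm_sub_rev y' x']
      linarith)
  rw [deriv_quadraticTest, gradient_quadraticTest] at hsub' hsuper'
  obtain ⟨hsubψ, hsubH⟩ := max_le_iff.1 hsub'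
  have hgrad : -k • (y' - x') + (2 * -β) • y' = k • (x' - y') - (2 * β) • y' := by
    module
  rw [hgrad] at hsuper'
  rcases le_max_iff.1 hsuper' with h | hsuperH
  · linarith
  have hl : ∀ a, P.l x' a p t' ≤ P.l y' a p s' + η / 4 := fun a => by
    have hR : ‖x'‖ ≤ (K + 1) / γ := by
      rw [le_div_iff₀ hγ0]
      linarith [hγnx]
    have h6 := (abs_lt.1 (hmt x' hR a t' ht' s' hs' (hts.trans_le h5))).2
    have h7 := (abs_lt.1 (hml x' y' a p s' hs' (hx.trans_le h4))).2
    linarith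
  have hM' : ∀ x a p, ‖P.f x a p‖ ≤ |M| + 1 := fun x a p => by
    linarith [hM x a p, le_abs_self M]
  have hH := hP.hamiltonian_sub_le p hM' hLip hk0.le hβ0.le ht' hl
  have h6 : L * (k * ‖x' - y'‖ ^ 2) ≤ η / 4 := by
    refine le_trans ?_ hεL
    have : 0 ≤ k * (t' - s') ^ 2 := by positivity
    exact mul_le_mul_of_nonneg_left (by linarith) hL.le
  have h7 : 2 * β * (|M| + 1) * (‖x'‖ + ‖y'‖) ≤ η / 4 := by
    calc 2 * β * (|M| + 1) * (‖x'‖ + ‖y'‖)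
        = 2 * γ * (|M| + 1) * (γ * ‖x'‖ + γ * ‖y'‖) := by rw [hβ]; ring
      _ ≤ 2 * γ * (|M| + 1) * ((K + 1) + (K + 1)) := by
          gcongr
      _ ≤ η / 4 := by linarith
  have h8 : 0 ≤ P.lam * (u x' t' - v y' s') := mul_nonneg hlam (by linarith)
  linarith

end Problem

end OptimalVisiting

end

theorem mainTheorem4 {d m N : ℕ} (P : OptimalVisiting.Problem d m N) (hP : P.Standing)
    (hC : ∀ p : Fin N → Bool, p ≠ OptimalVisiting.pbar N →
      ∃ K : ℝ, ∀ x, ∃ p' ∈ OptimalVisiting.switchSet p, P.C x p p' ≤ K)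
    (p : Fin N → Bool) (hp : p ≠ OptimalVisiting.pbar N) :
    P.IsBUCSolution p (P.value p) ∧
      ∀ u : EuclideanSpace ℝ (Fin d) → ℝ → ℝ, P.IsBUCSolution p u →
        ∀ x, ∀ t ∈ Set.Icc 0 P.T, u x t = P.value p x t := by
  have hV := hP.isBUC_value hC p
  have hψ := hP.isBUC_psi hp (hC p hp) fun p' _ => hP.isBUC_value hC p'
  have hsol : P.IsBUCSolution p (P.value p) :=
    ⟨hV, hP.isViscositySubsolution_value hp hV, hP.isViscositySupersolution_value hp hψ hV,
      hP.value_terminal hp⟩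
  refine ⟨hsol, fun u hu x t ht => le_antisymm ?_ ?_⟩
  · exact hP.le_of_subsolution_of_supersolution hψ hu.buc hV hu.sub hsol.super
      (fun x => by rw [hu.terminal, hsol.terminal]) x ht
  · exact hP.le_of_subsolution_of_supersolution hψ hV hu.buc hsol.sub hu.super
      (fun x => by rw [hu.terminal, hsol.terminal]) x ht
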